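/- Let $(\mathcal P,d,\mu)$ be a locally compact metric space with a $\sigma$-finite Borel regular measure such that every ball has finite positive measure. Let $X$ be a quasi-Banach function lattice over $(\mathcal P,\mu)$ of extended real-valued $\mu$-measurable functions defined everywhere: $X=\{u:\|u\|_X<\infty\}$, where $\|\cdot\|_X$, with values in $[0,\infty]$, satisfies for some constant $c\ge 1$ and all measurable $u,v,u_n$: * $\|u\|_X=0$ iff $u=0$ a.e.; $\|au\|_X=|a|\,\|u\|_X$ for $a\in\mathbb R$; $\|u+v\|_X\le c(\|u\|_X+\|v\|_X)$; * if $|u|\le|v|$ a.e., then $\|u\|_X\le\|v\|_X$; * if $u_n\ge0$ for all $n\ge 1$, then $\|\sum_{n\ge1}u_n\|_X\le\sum_{n\ge1}c^n\|u_n\|_X$; * if $u_n,u\in X$ and $\|u_n-u\|_X\to0$, then $\|u_n\|_X\to\|u\|_X$. A curve is a non-constant rectifiable curve $\gamma:[0,l_\gamma]\to\mathcal P$ parametrized by arc length. For a family $\Gamma$ of curves, $\mathrm{Mod}_X(\Gamma)$ is the infimum of $\|\rho\|_X$ over Borel $\rho:\mathcal P\to[0,\infty]$ with $\int_\gamma\rho\,ds\ge1$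 for all $\gamma\in\Gamma$; a property holds for $\mathrm{Mod}_X$-a.e. curve if the family of curves for which it fails has modulus zero. A Borel function $g:\mathcal P\to[0,\infty]$ is an upper gradient of $u:\mathcal P\to\overline{\mathbb R}$ if $|u(\gamma(0))-u(\gamma(l_\gamma))|\le\int_\gamma g\,ds$ for every curve $\gamma$, where $|(\pm\infty)-(\pm\infty)|=\infty$. For measurable $u$ let $\|u\|_{N^1X}=\|u\|_X+\inf_g\|g\|_X$, the infimum being over all upper gradients $g$ of $u$ (with $\inf\emptyset=\infty$), and let $N^1X=\{u \text{ measurable}:\|u\|_{N^1X}<\infty\}$. The capacity of $E\subset\mathcal P$ is $C_X(E)=\inf\{\|u\|_{N^1X}:u\ge1\text{ on }E\}$. A function $u:\mathcal P\to\overline{\mathbb R}$ is weakly quasi-continuous if for every $\varepsilon>0$ there is a set $E$ with $C_X(E)<\varepsilon$ such that $u|_{\mathcal P\setminus E}$ is real-valued and continuous, and quasi-continuous if $E$ can always be chosen open. Assume that the real-valued continuous functions in $N^1X$ are dense in $N^1X$, and that $X$ has the Vitali–Carathéodory property, i.e. $$\|u\|_X=\inf\{\|v\|_X: v\ge|u|\text{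 on }\mathcal P,\ v\text{ lower semicontinuous}\}\quad\text{for every measurable }u:\mathcal P\to\overline{\mathbb R}.$$ (Instead of the latter it suffices to assume that for every bounded measurable $B\subset\mathcal P$ one has $\chi_B\in X$, and $\|\chi_B\chi_{E_n}\|_X\to0$ for each decreasing sequence of measurable sets $E_n$ with $\mu(\bigcap_nE_n)=0$.) Let $u:\mathcal P\to\overline{\mathbb R}$ be such that $u=v$ a.e. for some $v\in N^1X$. Then the following are equivalent: 1. $u\in N^1X$; 2. $u\circ\gamma$ is (real-valued and) absolutely continuous for $\mathrm{Mod}_X$-a.e. curve $\gamma$; 3. $u$ is weakly quasi-continuous; 4. $u$ is quasi-continuous. -/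

import Mathlib

open MeasureTheory Filter Topology Set
open scoped ENNReal NNReal

noncomputable section

namespace NewtonianLattice

/-- A quasi-Banach function lattice over `(P, μ)`, given by its quasi-norm, which is evaluated on
extended real-valued `μ`-measurable functions defined everywhere (so it is a quasi-seminorm).
The values of `qnorm` on non-measurable functions are irrelevant. -/
structure QuasiBanachFunctionLattice {P : Type*} [MeasurableSpace P] (μ : Measure P) where
  /-- the quasi-norm -/
  qnorm : (P → EReal) → ℝ≥0∞
  /-- the modulus of concavity -/
  c : ℝ≥0
  one_le_c : 1 ≤ c
  qnorm_eq_zero_iff : ∀ u : P → EReal, AEMeasurable u μ → (qnorm u = 0 ↔ u =ᵐ[μ] 0)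
  qnorm_smul : ∀ (a : ℝ) (u : P → EReal), AEMeasurable u μ →
    qnorm (fun x => (a : EReal) * u x) = ENNReal.ofReal |a| * qnorm u
  qnorm_add_le : ∀ u v : P → EReal, AEMeasurable u μ → AEMeasurable v μ →
    qnorm (fun x => u x + v x) ≤ c * (qnorm u + qnorm v)
  /-- the lattice property -/
  qnorm_mono : ∀ u v : P → EReal, AEMeasurable u μ → AEMeasurable v μ →
    (∀ᵐ x ∂μ, (u x).abs ≤ (v x).abs) → qnorm u ≤ qnorm v
  /-- the Riesz–Fischer property (the sequence is indexed from `0`) -/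
  riesz_fischer : ∀ u : ℕ → P → ℝ≥0∞, (∀ n, AEMeasurable (u n) μ) →
    qnorm (fun x => ((∑' n, u n x : ℝ≥0∞) : EReal)) ≤
      ∑' n, (c : ℝ≥0∞) ^ (n + 1) * qnorm (fun x => (u n x : EReal))
  /-- continuity of the quasi-norm on the space `X` that it determines -/
  qnorm_continuous : ∀ (u : ℕ → P → EReal) (w : P → EReal),
    (∀ n, AEMeasurable (u n) μ) → AEMeasurable w μ → (∀ n, qnorm (u n) < ∞) → qnorm w < ∞ →
    Tendsto (fun n => qnorm (fun x => u n x - w x)) atTop (𝓝 0) →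
    Tendsto (fun n => qnorm (u n)) atTop (𝓝 (qnorm w))

/-- A curve in `P`: a non-constant rectifiable curve, parametrized by arc length on `[0, len]`
(the values of `toFun` outside `[0, len]` are irrelevant). -/
structure Curve (P : Type*) [MetricSpace P] where
  len : ℝ
  len_pos : 0 < len
  toFun : ℝ → P
  unitSpeed : HasUnitSpeedOn toFun (Icc 0 len)

/-- The line integral `∫_γ ρ ds` of a nonnegative function. -/
def Curve.lineIntegral {P : Type*} [MetricSpace P] (γ : Curve P) (ρ : P → ℝ≥0∞) : ℝ≥0∞ :=
  ∫⁻ t in Icc 0 γ.len, ρ (γ.toFun t)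

/-- `u ∘ γ` is (real-valued and) absolutely continuous on `[0, len]`. -/
def Curve.IsAbsContAlong {P : Type*} [MetricSpace P] (γ : Curve P) (u : P → EReal) : Prop :=
  ∃ f : ℝ → ℝ, (∀ t ∈ Icc 0 γ.len, u (γ.toFun t) = (f t : EReal)) ∧
    AbsolutelyContinuousOnInterval f 0 γ.len

open Classical in
/-- `|a - b|` for extended reals, which is `∞` as soon as `a` or `b` is infinite; in particular
`|(±∞) - (±∞)| = ∞`. -/
def absDiff (a b : EReal) : ℝ≥0∞ :=
  if (a ≠ ⊤ ∧ a ≠ ⊥) ∧ (b ≠ ⊤ ∧ b ≠ ⊥) then ENNReal.ofReal |a.toReal - b.toReal| else ∞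

/-- The Borel function `g : P → [0, ∞]` is an upper gradient of `u`. -/
def IsUpperGradient {P : Type*} [MetricSpace P] [MeasurableSpace P]
    (g : P → ℝ≥0∞) (u : P → EReal) : Prop :=
  Measurable g ∧
    ∀ γ : Curve P, absDiff (u (γ.toFun 0)) (u (γ.toFun γ.len)) ≤ γ.lineIntegral g

/-- `u` is real-valued and continuous on the set `A`, i.e. so is the restriction `u|_A`. -/
def IsRealContinuousOn {P : Type*} [TopologicalSpace P] (u : P → EReal) (A : Set P) : Prop :=
  (∀ x ∈ A, u x ≠ ⊤ ∧ u x ≠ ⊥) ∧ ContinuousOn u A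

namespace QuasiBanachFunctionLattice

variable {P : Type*} [MetricSpace P] [MeasurableSpace P] {μ : Measure P}

/-- Membership in the function lattice `X`. -/
def Mem (X : QuasiBanachFunctionLattice μ) (u : P → EReal) : Prop :=
  AEMeasurable u μ ∧ X.qnorm u < ∞

/-- The `X`-modulus of a family of curves. -/
def modulus (X : QuasiBanachFunctionLattice μ) (Γ : Set (Curve P)) : ℝ≥0∞ :=
  ⨅ (ρ : P → ℝ≥0∞) (_ : Measurable ρ) (_ : ∀ γ ∈ Γ, 1 ≤ γ.lineIntegral ρ),
    X.qnorm (fun x => (ρ x : EReal))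

/-- The property `p` holds for `Mod_X`-a.e. curve. -/
def AECurve (X : QuasiBanachFunctionLattice μ) (p : Curve P → Prop) : Prop :=
  X.modulus {γ | ¬ p γ} = 0

/-- The Newtonian quasi-norm `‖u‖_{N¹X} = ‖u‖_X + inf_g ‖g‖_X`, where `g` runs through all upper
gradients of `u`. -/
def newtonNorm (X : QuasiBanachFunctionLattice μ) (u : P → EReal) : ℝ≥0∞ :=
  X.qnorm u + ⨅ (g : P → ℝ≥0∞) (_ : IsUpperGradient g u), X.qnorm (fun x => (g x : EReal))

/-- Membership in the Newtonian space `N¹X`. -/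
def MemNewton (X : QuasiBanachFunctionLattice μ) (u : P → EReal) : Prop :=
  AEMeasurable u μ ∧ X.newtonNorm u < ∞

/-- The Sobolev `X`-capacity `C_X`. -/
def capacity (X : QuasiBanachFunctionLattice μ) (E : Set P) : ℝ≥0∞ :=
  ⨅ (u : P → EReal) (_ : AEMeasurable u μ) (_ : ∀ x ∈ E, 1 ≤ u x), X.newtonNorm u

/-- Weak quasi-continuity. -/
def WeaklyQuasiContinuous (X : QuasiBanachFunctionLattice μ) (u : P → EReal) : Prop :=
  ∀ ε : ℝ≥0∞, 0 < ε → ∃ E : Set P, X.capacity E < ε ∧ IsRealContinuousOn u Eᶜ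

/-- Quasi-continuity. -/
def QuasiContinuous (X : QuasiBanachFunctionLattice μ) (u : P → EReal) : Prop :=
  ∀ ε : ℝ≥0∞, 0 < ε → ∃ E : Set P, IsOpen E ∧ X.capacity E < ε ∧ IsRealContinuousOn u Eᶜ

/-- (Real-valued) continuous functions are dense in `N¹X`. -/
def ContinuousDense (X : QuasiBanachFunctionLattice μ) : Prop :=
  ∀ u : P → EReal, X.MemNewton u → ∀ ε : ℝ≥0∞, 0 < ε →
    ∃ f : P → ℝ, Continuous f ∧ X.MemNewton (fun x => (f x : EReal)) ∧
      X.newtonNorm (fun x => u x - (f x : EReal)) < ε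

/-- The Vitali–Carathéodory property. -/
def VitaliCaratheodory (X : QuasiBanachFunctionLattice μ) : Prop :=
  ∀ u : P → EReal, AEMeasurable u μ →
    X.qnorm u = ⨅ (v : P → EReal) (_ : LowerSemicontinuous v)
      (_ : ∀ x, ((u x).abs : EReal) ≤ v x), X.qnorm v

/-- The function `u` has absolutely continuous quasi-norm in `X`. -/
def HasAbsContNorm (X : QuasiBanachFunctionLattice μ) (u : P → EReal) : Prop :=
  ∀ E : ℕ → Set P, (∀ n, NullMeasurableSet (E n) μ) → Antitone E → μ (⋂ n, E n) = 0 →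
    Tendsto (fun n => X.qnorm ((E n).indicator u)) atTop (𝓝 0)

/-- For every bounded measurable set `B`, the characteristic function of `B` belongs to `X` and
has absolutely continuous quasi-norm in `X`. -/
def BoundedSetsAbsCont (X : QuasiBanachFunctionLattice μ) : Prop :=
  ∀ B : Set P, Bornology.IsBounded B → NullMeasurableSet B μ →
    X.Mem (B.indicator 1) ∧ X.HasAbsContNorm (B.indicator 1)

end QuasiBanachFunctionLattice

end NewtonianLattice

end

/-!
A function in `N¹X` is absolutely continuous along almost every curve, because its upper gradient
is integrable along almost every curve. Conversely, a function `u` that is absolutely continuous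
along almost every curve and agrees almost everywhere with `v ∈ N¹X` agrees with `v` at every point
of almost every curve, since almost every curve spends no time in a given null set; so an upper
gradient of `v`, enlarged on an exceptional family of curves, is an upper gradient of `u`
(`AECurve.memNewton`).

Density of continuous functions yields, by a telescoping argument, that `u ∈ N¹X` is a uniform limit
of continuous functions outside `G ∪ Z`, where `G` is open of small capacity and `Z` has capacity
zero (`MemNewton.quasiContinuous`). The heart of the matter is to enclose `Z` in an open set of
small capacity (`HasLscMajorants.exists_isOpen_capacity_lt`). Almost every curve avoids `Z`, so some
density `ρ` of small quasi-norm has infinite integral along every curve that meets `Z`; by the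
Vitali–Carathéodory property `ρ` may be taken lower semicontinuous. In a relatively compact open
neighbourhood `V` of `Z` whose characteristic function has small quasi-norm, consider the least
`(ρ + 1)`-length of paths that lead from a point out of `V`, truncated at `1`. This function has
`(ρ + 1) χ_V` as an upper gradient, equals `1` on `Z`, vanishes outside `V`, and is lower
semicontinuous by the Arzelà–Ascoli theorem and Fatou's lemma, so that its superlevel sets are open
(`lowerSemicontinuous_min_escapeCost`, `exists_isOpen_capacity_le`). If bounded sets have absolutely
continuous quasi-norm, a weak form of the Vitali–Carathéodory property that suffices here follows
from the outer regularity of the measure (`BoundedSetsAbsCont.hasLscMajorants`).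

Once all functions in `N¹X` are quasi-continuous, applying this to test functions of the capacity
shows that sets of small capacity lie in open sets of small capacity, so weak quasi-continuity
implies quasi-continuity. Finally, if `u` and `v` are quasi-continuous and agree almost everywhere,
then for a suitable open set `G` of small capacity the set `{u ≠ v} ∪ G` is open; a curve that meets
`{u ≠ v}` spends a positive amount of time in this open set but none in the null set `{u ≠ v}`, so
it meets `G`. For almost every curve this fails for some `G` of a sequence of such sets, whence
`u = v` along almost every curve (`QuasiContinuous.aeCurve_isAbsContAlong`).
-/

noncomputable section

namespace NewtonianLattice

/-! ### The quasi-norm on nonnegative functions -/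

theorem measurable_eReal_abs : Measurable EReal.abs := by
  refine EReal.measurable_of_measurable_real ?_
  simp only [EReal.abs_def]
  fun_prop

theorem aemeasurable_eReal_abs {α : Type*} [MeasurableSpace α] {μ : Measure α} {u : α → EReal}
    (hu : AEMeasurable u μ) : AEMeasurable (fun x => (u x).abs) μ :=
  measurable_eReal_abs.comp_aemeasurable hu

theorem abs_coe_ennreal (a : ℝ≥0∞) : (a : EReal).abs = a := by
  induction a with
  | top => rfl
  | coe a =>
    have : ((a : ℝ≥0∞) : EReal) = ((a : ℝ) : EReal) := rfl
    rw [this, EReal.abs_def, NNReal.abs_eq]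
    simp

/-- Every almost everywhere measurable function has a Borel majorant that differs from it only on
a null set. -/
theorem exists_measurable_ge_ae_eq {α : Type*} [MeasurableSpace α] {μ : Measure α}
    {w : α → ℝ≥0∞} (hw : AEMeasurable w μ) :
    ∃ w' : α → ℝ≥0∞, Measurable w' ∧ (∀ x, w x ≤ w' x) ∧ w' =ᵐ[μ] w := by
  obtain ⟨N, hN, hNm, hN0⟩ := exists_measurable_superset_of_null (ae_iff.1 hw.ae_eq_mk)
  refine ⟨fun x => hw.mk w x + N.indicator (fun _ => ∞) x,
    hw.measurable_mk.add (measurable_const.indicator hNm), fun x => ?_, ?_⟩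
  · by_cases hx : x ∈ N
    · simp [hx]
    · have : w x = hw.mk w x := by
        by_contra h
        exact hx (hN h)
      simp [hx, this]
  · have h1 : ∀ᵐ x ∂μ, x ∉ N := measure_eq_zero_iff_ae_notMem.1 hN0
    filter_upwards [h1, hw.ae_eq_mk] with x hx hx'
    simp [hx, hx']

/-- Positive weights whose series, weighted by the constants of the Riesz–Fischer property, is
small. -/
theorem exists_pos_tsum_mul_pow_lt (c : ℝ≥0) (hc : 1 ≤ c) {ε : ℝ≥0∞} (hε : 0 < ε) :
    ∃ δ : ℕ → ℝ≥0∞, (∀ n, 0 < δ n) ∧ ∑' n, (c : ℝ≥0∞) ^ (n + 1) * δ n < ε := by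
  obtain ⟨ε', h0, h1⟩ := ENNReal.exists_pos_sum_of_countable hε.ne' ℕ
  have hc0 : c ≠ 0 := (zero_lt_one.trans_le hc).ne'
  refine ⟨fun n => (ε' n : ℝ≥0∞) / (c : ℝ≥0∞) ^ (n + 1), fun n => ?_, ?_⟩
  · exact ENNReal.div_pos (by simpa using (h0 n).ne') (by finiteness)
  · convert h1 using 3 with n
    exact ENNReal.mul_div_cancel (by simp [hc0]) (by finiteness)

namespace QuasiBanachFunctionLattice

section Norm

variable {P : Type*} [MeasurableSpace P] {μ : Measure P}

/-- The quasi-norm of a `[0, ∞]`-valued function. -/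
def eNorm (X : QuasiBanachFunctionLattice μ) (ρ : P → ℝ≥0∞) : ℝ≥0∞ :=
  X.qnorm (fun x => (ρ x : EReal))

variable (X : QuasiBanachFunctionLattice μ)

theorem one_le_coe_c : (1 : ℝ≥0∞) ≤ X.c := by exact_mod_cast X.one_le_c

theorem eNorm_mono_ae {ρ σ : P → ℝ≥0∞} (hρ : AEMeasurable ρ μ) (hσ : AEMeasurable σ μ)
    (h : ∀ᵐ x ∂μ, ρ x ≤ σ x) : X.eNorm ρ ≤ X.eNorm σ := by
  refine X.qnorm_mono _ _ hρ.coe_ereal_ennreal hσ.coe_ereal_ennreal ?_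
  simpa only [abs_coe_ennreal] using h

theorem eNorm_mono {ρ σ : P → ℝ≥0∞} (hρ : AEMeasurable ρ μ) (hσ : AEMeasurable σ μ)
    (h : ∀ x, ρ x ≤ σ x) : X.eNorm ρ ≤ X.eNorm σ :=
  X.eNorm_mono_ae hρ hσ (ae_of_all _ h)

theorem eNorm_abs {u : P → EReal} (hu : AEMeasurable u μ) :
    X.eNorm (fun x => (u x).abs) = X.qnorm u := by
  have h := (aemeasurable_eReal_abs hu).coe_ereal_ennreal
  refine le_antisymm (X.qnorm_mono _ _ h hu ?_) (X.qnorm_mono _ _ hu h ?_) <;>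
    simp [abs_coe_ennreal]

theorem qnorm_congr_ae {u v : P → EReal} (hv : AEMeasurable v μ) (h : u =ᵐ[μ] v) :
    X.qnorm u = X.qnorm v := by
  have hu : AEMeasurable u μ := hv.congr h.symm
  refine le_antisymm (X.qnorm_mono _ _ hu hv ?_) (X.qnorm_mono _ _ hv hu ?_) <;>
    filter_upwards [h] with x hx <;> rw [hx]

theorem eNorm_add_le {ρ σ : P → ℝ≥0∞} (hρ : AEMeasurable ρ μ) (hσ : AEMeasurable σ μ) :
    X.eNorm (fun x => ρ x + σ x) ≤ X.c * (X.eNorm ρ + X.eNorm σ) := by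
  have := X.qnorm_add_le _ _ hρ.coe_ereal_ennreal hσ.coe_ereal_ennreal
  simpa only [eNorm, EReal.coe_ennreal_add] using this

theorem eNorm_tsum_le {ρ : ℕ → P → ℝ≥0∞} (hρ : ∀ n, AEMeasurable (ρ n) μ) :
    X.eNorm (fun x => ∑' n, ρ n x) ≤ ∑' n, (X.c : ℝ≥0∞) ^ (n + 1) * X.eNorm (ρ n) :=
  X.riesz_fischer ρ hρ

theorem eNorm_const_mul (a : ℝ≥0) {ρ : P → ℝ≥0∞} (hρ : AEMeasurable ρ μ) :
    X.eNorm (fun x => a * ρ x) = a * X.eNorm ρ := by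
  have h := X.qnorm_smul a _ hρ.coe_ereal_ennreal
  rw [NNReal.abs_eq, ENNReal.ofReal_coe_nnreal] at h
  rw [eNorm, eNorm, ← h]
  congr 1
  ext x
  rw [EReal.coe_ennreal_mul]
  rfl

theorem eNorm_eq_zero {ρ : P → ℝ≥0∞} (h : ρ =ᵐ[μ] 0) : X.eNorm ρ = 0 := by
  have hρ : AEMeasurable ρ μ := aemeasurable_const.congr h.symm
  refine (X.qnorm_eq_zero_iff _ hρ.coe_ereal_ennreal).2 ?_
  filter_upwards [h] with x hx
  simp [hx]

theorem eNorm_indicator_null {N : Set P} (hN : μ N = 0) (a : ℝ≥0∞) :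
    X.eNorm (N.indicator fun _ => a) = 0 :=
  X.eNorm_eq_zero (indicator_meas_zero hN)

theorem eNorm_congr_ae {ρ σ : P → ℝ≥0∞} (hσ : AEMeasurable σ μ) (h : ρ =ᵐ[μ] σ) :
    X.eNorm ρ = X.eNorm σ := by
  refine X.qnorm_congr_ae hσ.coe_ereal_ennreal ?_
  filter_upwards [h] with x hx
  rw [hx]

theorem eNorm_add_lt_top {ρ σ : P → ℝ≥0∞} (hρ : AEMeasurable ρ μ) (hσ : AEMeasurable σ μ)
    (h1 : X.eNorm ρ < ∞) (h2 : X.eNorm σ < ∞) : X.eNorm (fun x => ρ x + σ x) < ∞ :=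
  (X.eNorm_add_le hρ hσ).trans_lt (by finiteness)

/-- A function of finite quasi-norm can be scaled to have small quasi-norm. -/
theorem exists_pos_eNorm_const_mul_lt {ρ : P → ℝ≥0∞} (hρ : AEMeasurable ρ μ)
    (h : X.eNorm ρ < ∞) {ε : ℝ≥0∞} (hε : 0 < ε) :
    ∃ a : ℝ≥0, 0 < a ∧ X.eNorm (fun x => a * ρ x) < ε := by
  obtain ⟨a, ha, ha'⟩ := ENNReal.exists_nnreal_pos_mul_lt h.ne hε.ne'
  exact ⟨a, ha, by rwa [X.eNorm_const_mul a hρ]⟩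

end Norm

end QuasiBanachFunctionLattice

/-! ### Curves and line integrals -/

section Curves

variable {P : Type*} [MetricSpace P]

namespace Curve

variable (γ : Curve P)

theorem lipschitzOnWith : LipschitzOnWith 1 γ.toFun (Icc 0 γ.len) := by
  have key : ∀ s ∈ Icc 0 γ.len, ∀ t ∈ Icc 0 γ.len, s ≤ t →
      edist (γ.toFun s) (γ.toFun t) ≤ edist s t := by
    intro s hs t ht hst
    have h1 := γ.unitSpeed hs ht
    have h2 := eVariationOn.edist_le γ.toFun (s := Icc 0 γ.len ∩ Icc s t) (x := s) (y := t)
      ⟨hs, left_mem_Icc.2 hst⟩ ⟨ht, right_mem_Icc.2 hst⟩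
    rw [h1] at h2
    refine h2.trans_eq ?_
    rw [edist_comm, edist_dist, Real.dist_eq, abs_of_nonneg (sub_nonneg.2 hst)]
    simp
  intro s hs t ht
  rw [ENNReal.coe_one, one_mul]
  rcases le_total s t with h | h
  · exact key s hs t ht h
  · rw [edist_comm, edist_comm s]
    exact key t ht s hs h

theorem continuousOn : ContinuousOn γ.toFun (Icc 0 γ.len) := γ.lipschitzOnWith.continuousOn

theorem aemeasurable [MeasurableSpace P] [BorelSpace P] :
    AEMeasurable γ.toFun (volume.restrict (Icc 0 γ.len)) :=
  γ.continuousOn.aemeasurable measurableSet_Icc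

theorem lineIntegral_mono {ρ σ : P → ℝ≥0∞} (h : ∀ x, ρ x ≤ σ x) :
    γ.lineIntegral ρ ≤ γ.lineIntegral σ :=
  lintegral_mono fun _ => h _

theorem lineIntegral_add [MeasurableSpace P] [BorelSpace P] {ρ : P → ℝ≥0∞} (hρ : Measurable ρ)
    (σ : P → ℝ≥0∞) :
    γ.lineIntegral (fun x => ρ x + σ x) = γ.lineIntegral ρ + γ.lineIntegral σ :=
  lintegral_add_left' (hρ.comp_aemeasurable γ.aemeasurable) _

theorem lineIntegral_tsum [MeasurableSpace P] [BorelSpace P] {ρ : ℕ → P → ℝ≥0∞}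
    (hρ : ∀ n, Measurable (ρ n)) :
    γ.lineIntegral (fun x => ∑' n, ρ n x) = ∑' n, γ.lineIntegral (ρ n) :=
  lintegral_tsum fun n => (hρ n).comp_aemeasurable γ.aemeasurable

theorem lineIntegral_const_mul (a : ℝ≥0) (ρ : P → ℝ≥0∞) :
    γ.lineIntegral (fun x => a * ρ x) = a * γ.lineIntegral ρ :=
  lintegral_const_mul' _ _ ENNReal.coe_ne_top

/-- If the line integral of `∞ · χ_N` is finite, then the curve spends no time in `N`. -/
theorem ae_notMem_of_lineIntegral_lt_top [MeasurableSpace P] [BorelSpace P] {N : Set P}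
    (hN : MeasurableSet N) (h : γ.lineIntegral (N.indicator fun _ => ∞) < ∞) :
    ∀ᵐ t ∂volume.restrict (Icc 0 γ.len), γ.toFun t ∉ N := by
  have := ae_lt_top' ((measurable_const.indicator hN).comp_aemeasurable γ.aemeasurable) h.ne
  filter_upwards [this] with t ht hmem
  simp [hmem] at ht

/-- The restriction of a curve to the parameter interval `[s, t]`. -/
def restrict {s t : ℝ} (hs : 0 ≤ s) (hst : s < t) (ht : t ≤ γ.len) : Curve P where
  len := t - s
  len_pos := sub_pos.2 hst
  toFun := fun τ => γ.toFun (s + τ)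
  unitSpeed := by
    intro x hx y hy
    have hmaps : (fun τ => s + τ) '' (Icc 0 (t - s) ∩ Icc x y)
        = Icc 0 γ.len ∩ Icc (s + x) (s + y) := by
      ext z
      simp only [mem_image, mem_inter_iff, mem_Icc] at hx hy ⊢
      constructor
      · rintro ⟨τ, h, rfl⟩
        refine ⟨⟨?_, ?_⟩, ?_, ?_⟩ <;> linarith [h.1.1, h.1.2, h.2.1, h.2.2]
      · intro h
        refine ⟨z - s, ⟨⟨?_, ?_⟩, ?_, ?_⟩, ?_⟩ <;> linarith [h.1.1, h.1.2, h.2.1, h.2.2]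
    have h1 := eVariationOn.comp_eq_of_monotoneOn γ.toFun (t := Icc 0 (t - s) ∩ Icc x y)
      (fun τ => s + τ) (fun a _ b _ hab => by simpa using hab)
    rw [hmaps] at h1
    have h2 := γ.unitSpeed (x := s + x) (y := s + y)
      ⟨by linarith [hx.1], by linarith [hx.2]⟩ ⟨by linarith [hy.1], by linarith [hy.2]⟩
    rw [h2] at h1
    simpa [Function.comp_def] using h1

theorem lineIntegral_restrict {s t : ℝ} (hs : 0 ≤ s) (hst : s < t) (ht : t ≤ γ.len)
    (ρ : P → ℝ≥0∞) :
    (γ.restrict hs hst ht).lineIntegral ρ = ∫⁻ τ in Icc s t, ρ (γ.toFun τ) := by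
  have h := (measurePreserving_add_left (volume : Measure ℝ) s).setLIntegral_comp_preimage_emb
    (measurableEmbedding_addLeft s) (fun τ => ρ (γ.toFun τ)) (Icc s t)
  rw [← h]
  simp [lineIntegral, restrict]

end Curve

end Curves

/-! ### Exceptional families of curves -/

section

variable {P : Type*} [MetricSpace P] [MeasurableSpace P] {μ : Measure P}

namespace QuasiBanachFunctionLattice

variable (X : QuasiBanachFunctionLattice μ)

/-- If the line integrals of one function of finite quasi-norm are infinite on all exceptional
curves, then these have modulus zero: scale the function down. -/
theorem aeCurve_of_lineIntegral_eq_top {p : Curve P → Prop} {ρ : P → ℝ≥0∞} (hρ : Measurable ρ)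
    (hfin : X.eNorm ρ < ∞) (h : ∀ γ, γ.lineIntegral ρ < ∞ → p γ) : X.AECurve p := by
  refine le_antisymm (le_of_forall_gt fun ε hε => ?_) bot_le
  obtain ⟨a, ha, hlt⟩ := X.exists_pos_eNorm_const_mul_lt hρ.aemeasurable hfin hε
  refine lt_of_le_of_lt (iInf_le_of_le (fun x => a * ρ x) <| iInf_le_of_le (hρ.const_mul _) <|
    iInf_le_of_le (fun γ hγ => ?_) le_rfl) hlt
  have : γ.lineIntegral ρ = ∞ := by
    by_contra hne
    exact hγ (h γ (lt_top_iff_ne_top.2 hne))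
  rw [γ.lineIntegral_const_mul, this, ENNReal.mul_top (by simpa using ha.ne')]
  exact le_top

variable [BorelSpace P]

/-- The exceptional curves of a property that holds almost everywhere are detected by a single
function of finite quasi-norm. -/
theorem AECurve.exists_lineIntegral_eq_top {X : QuasiBanachFunctionLattice μ}
    {p : Curve P → Prop} (h : X.AECurve p) :
    ∃ ρ : P → ℝ≥0∞, Measurable ρ ∧ X.eNorm ρ < ∞ ∧ ∀ γ, γ.lineIntegral ρ < ∞ → p γ := by
  obtain ⟨δ, hδ, hsum⟩ := exists_pos_tsum_mul_pow_lt X.c X.one_le_c (ε := 1) one_pos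
  have hex : ∀ n, ∃ ρ : P → ℝ≥0∞, Measurable ρ ∧ (∀ γ, ¬ p γ → 1 ≤ γ.lineIntegral ρ) ∧
      X.eNorm ρ < δ n := by
    intro n
    have h' : X.modulus {γ | ¬ p γ} < δ n := by
      rw [show X.modulus {γ | ¬ p γ} = 0 from h]
      exact hδ n
    simp only [modulus, iInf_lt_iff] at h'
    obtain ⟨ρ, h1, h2, h3⟩ := h'
    exact ⟨ρ, h1, h2, h3⟩
  choose ρ hρ hρp hρδ using hex
  refine ⟨fun x => ∑' n, ρ n x, Measurable.tsum hρ, ?_, fun γ hγ => ?_⟩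
  · refine (X.eNorm_tsum_le fun n => (hρ n).aemeasurable).trans_lt ?_
    refine lt_of_le_of_lt (ENNReal.tsum_le_tsum fun n => ?_) (hsum.trans ENNReal.one_lt_top)
    gcongr
    exact (hρδ n).le
  · by_contra hp
    rw [γ.lineIntegral_tsum hρ] at hγ
    refine hγ.ne (top_le_iff.1 ?_)
    calc ∞ = ∑' _ : ℕ, (1 : ℝ≥0∞) := (ENNReal.tsum_const_eq_top_of_ne_zero one_ne_zero).symm
      _ ≤ _ := ENNReal.tsum_le_tsum fun n => hρp n γ hp

end QuasiBanachFunctionLattice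

/-! ### Upper gradients of nonnegative functions -/

/-- One-sided form of the upper gradient inequality for `[0, ∞]`-valued functions. In contrast to
`IsUpperGradient`, it does not forbid that `w` is infinite at both ends of a curve along which `g`
is integrable; it is therefore stable under countable sums. -/
structure IsGradientBound (g w : P → ℝ≥0∞) : Prop where
  measurable : Measurable g
  le_left : ∀ γ : Curve P, w (γ.toFun 0) ≤ w (γ.toFun γ.len) + γ.lineIntegral g
  le_right : ∀ γ : Curve P, w (γ.toFun γ.len) ≤ w (γ.toFun 0) + γ.lineIntegral g

theorem coe_ennreal_ne_bot_top {a : ℝ≥0∞} (ha : a ≠ ∞) : (a : EReal) ≠ ⊤ ∧ (a : EReal) ≠ ⊥ :=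
  ⟨by simpa using ha, EReal.coe_ennreal_ne_bot a⟩

theorem absDiff_coe_ennreal_le {a b c : ℝ≥0∞} (ha : a ≠ ∞) (hb : b ≠ ∞) (hab : a ≤ b + c)
    (hba : b ≤ a + c) : absDiff a b ≤ c := by
  rw [absDiff, if_pos ⟨coe_ennreal_ne_bot_top ha, coe_ennreal_ne_bot_top hb⟩]
  rcases eq_or_ne c ∞ with rfl | hc
  · exact le_top
  refine ENNReal.ofReal_le_of_le_toReal ?_
  rw [EReal.toReal_coe_ennreal, EReal.toReal_coe_ennreal, abs_sub_le_iff]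
  have h1 := ENNReal.toReal_mono (by finiteness) hab
  have h2 := ENNReal.toReal_mono (by finiteness) hba
  rw [ENNReal.toReal_add (by finiteness) hc] at h1 h2
  constructor <;> linarith

theorem abs_le_abs_add_absDiff (a b : EReal) : a.abs ≤ b.abs + absDiff a b := by
  by_cases h : (a ≠ ⊤ ∧ a ≠ ⊥) ∧ (b ≠ ⊤ ∧ b ≠ ⊥)
  · rw [absDiff, if_pos h]
    lift a to ℝ using h.1
    lift b to ℝ using h.2
    rw [EReal.abs_def, EReal.abs_def, ← ENNReal.ofReal_add (abs_nonneg _) (abs_nonneg _)]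
    refine ENNReal.ofReal_le_ofReal ?_
    simp only [EReal.toReal_coe]
    linarith [abs_sub_abs_le_abs_sub a b]
  · rw [absDiff, if_neg h]
    simp

theorem absDiff_comm (a b : EReal) : absDiff a b = absDiff b a := by
  unfold absDiff
  simp only [and_comm (a := a ≠ ⊤ ∧ a ≠ ⊥), abs_sub_comm]

theorem IsUpperGradient.isGradientBound {g : P → ℝ≥0∞} {u : P → EReal}
    (h : IsUpperGradient g u) : IsGradientBound g (fun x => (u x).abs) where
  measurable := h.1
  le_left γ := (abs_le_abs_add_absDiff _ _).trans (by gcongr; exact h.2 γ)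
  le_right γ := (abs_le_abs_add_absDiff _ _).trans (by
    gcongr
    rw [absDiff_comm]
    exact h.2 γ)

theorem IsGradientBound.isUpperGradient {g w : P → ℝ≥0∞} (h : IsGradientBound g w)
    (hw : ∀ x, w x ≠ ∞) : IsUpperGradient g (fun x => (w x : EReal)) :=
  ⟨h.measurable, fun γ => absDiff_coe_ennreal_le (hw _) (hw _) (h.le_left γ) (h.le_right γ)⟩

namespace IsGradientBound

theorem min_one {g w : P → ℝ≥0∞} (h : IsGradientBound g w) :
    IsGradientBound g (fun x => min 1 (w x)) where
  measurable := h.measurable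
  le_left γ := by
    rw [← min_add_add_right]
    exact min_le_min le_self_add (h.le_left γ)
  le_right γ := by
    rw [← min_add_add_right]
    exact min_le_min le_self_add (h.le_right γ)

theorem const_mul {g w : P → ℝ≥0∞} (h : IsGradientBound g w) (a : ℝ≥0) :
    IsGradientBound (fun x => a * g x) (fun x => a * w x) where
  measurable := h.measurable.const_mul _
  le_left γ := by
    rw [γ.lineIntegral_const_mul, ← mul_add]
    gcongr
    exact h.le_left γ
  le_right γ := by
    rw [γ.lineIntegral_const_mul, ← mul_add]
    gcongr
    exact h.le_right γ

/-- The inequality holds between any two points of a curve. -/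
theorem le_add_lineIntegral {g w : P → ℝ≥0∞} (h : IsGradientBound g w) (γ : Curve P) {s t : ℝ}
    (hs : s ∈ Icc 0 γ.len) (ht : t ∈ Icc 0 γ.len) :
    w (γ.toFun s) ≤ w (γ.toFun t) + γ.lineIntegral g := by
  have hle : ∀ {a b : ℝ} (ha : 0 ≤ a) (hab : a < b) (hb : b ≤ γ.len),
      (γ.restrict ha hab hb).lineIntegral g ≤ γ.lineIntegral g := by
    intro a b ha hab hb
    rw [γ.lineIntegral_restrict]
    exact lintegral_mono_set (Icc_subset_Icc ha hb)
  rcases lt_trichotomy s t with hst | rfl | hst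
  · have := h.le_left (γ.restrict hs.1 hst ht.2)
    refine le_trans (by simpa [Curve.restrict] using this) (add_le_add_right (hle hs.1 hst ht.2) _)
  · exact le_self_add
  · have := h.le_right (γ.restrict ht.1 hst hs.2)
    refine le_trans (by simpa [Curve.restrict] using this) (add_le_add_right (hle ht.1 hst hs.2) _)

variable [BorelSpace P]

theorem tsum {g w : ℕ → P → ℝ≥0∞} (h : ∀ n, IsGradientBound (g n) (w n)) :
    IsGradientBound (fun x => ∑' n, g n x) (fun x => ∑' n, w n x) where
  measurable := Measurable.tsum fun n => (h n).measurable
  le_left γ := by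
    rw [γ.lineIntegral_tsum fun n => (h n).measurable, ← ENNReal.tsum_add]
    exact ENNReal.tsum_le_tsum fun n => (h n).le_left γ
  le_right γ := by
    rw [γ.lineIntegral_tsum fun n => (h n).measurable, ← ENNReal.tsum_add]
    exact ENNReal.tsum_le_tsum fun n => (h n).le_right γ

theorem add {g w g' w' : P → ℝ≥0∞} (h : IsGradientBound g w) (h' : IsGradientBound g' w') :
    IsGradientBound (fun x => g x + g' x) (fun x => w x + w' x) where
  measurable := h.measurable.add h'.measurable
  le_left γ := by
    rw [γ.lineIntegral_add h.measurable, add_add_add_comm]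
    exact add_le_add (h.le_left γ) (h'.le_left γ)
  le_right γ := by
    rw [γ.lineIntegral_add h.measurable, add_add_add_comm]
    exact add_le_add (h.le_right γ) (h'.le_right γ)

end IsGradientBound

/-! ### Absolute continuity along curves -/

theorem absDiff_eq_top_left {a : EReal} (h : ¬ (a ≠ ⊤ ∧ a ≠ ⊥)) (b : EReal) :
    absDiff a b = ∞ := by
  rw [absDiff, if_neg fun h' => h h'.1]

/-- A function with an upper gradient is absolutely continuous along every curve on which the upper
gradient is integrable. -/
theorem IsUpperGradient.isAbsContAlong {g : P → ℝ≥0∞} {u : P → EReal} (h : IsUpperGradient g u)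
    {γ : Curve P} (hγ : γ.lineIntegral g < ∞) : γ.IsAbsContAlong u := by
  have hsub : ∀ {s t : ℝ}, 0 ≤ s → s < t → t ≤ γ.len →
      absDiff (u (γ.toFun s)) (u (γ.toFun t)) ≤ ∫⁻ τ in Icc s t, g (γ.toFun τ) := by
    intro s t hs hst ht
    have := h.2 (γ.restrict hs hst ht)
    rw [γ.lineIntegral_restrict] at this
    simpa [Curve.restrict] using this
  have hfin : ∀ {s t : ℝ}, 0 ≤ s → t ≤ γ.len → ∫⁻ τ in Icc s t, g (γ.toFun τ) < ∞ :=
    fun hs ht => (lintegral_mono_set (Icc_subset_Icc hs ht)).trans_lt hγ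
  have hreal : ∀ t ∈ Icc 0 γ.len, u (γ.toFun t) ≠ ⊤ ∧ u (γ.toFun t) ≠ ⊥ := by
    intro t ht
    by_contra hbad
    rcases eq_or_lt_of_le ht.1 with rfl | h0
    · have := hsub le_rfl γ.len_pos le_rfl
      rw [absDiff_eq_top_left hbad] at this
      exact (hfin le_rfl le_rfl).ne (top_le_iff.1 this)
    · have := hsub le_rfl h0 ht.2
      rw [absDiff_comm, absDiff_eq_top_left hbad] at this
      exact (hfin le_rfl ht.2).ne (top_le_iff.1 this)
  refine ⟨fun t => (u (γ.toFun t)).toReal, fun t ht => ?_, ?_⟩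
  · exact (EReal.coe_toReal (hreal t ht).1 (hreal t ht).2).symm
  have hbound : ∀ s ∈ Icc 0 γ.len, ∀ t ∈ Icc 0 γ.len,
      ENNReal.ofReal (dist (u (γ.toFun s)).toReal (u (γ.toFun t)).toReal)
        ≤ ∫⁻ τ in uIoc s t, g (γ.toFun τ) := by
    have key : ∀ s ∈ Icc 0 γ.len, ∀ t ∈ Icc 0 γ.len, s < t →
        ENNReal.ofReal (dist (u (γ.toFun s)).toReal (u (γ.toFun t)).toReal)
        ≤ ∫⁻ τ in uIoc s t, g (γ.toFun τ) := by
      intro s hs t ht hst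
      have := hsub hs.1 hst ht.2
      rw [absDiff, if_pos ⟨hreal s hs, hreal t ht⟩, ← setLIntegral_congr Ioc_ae_eq_Icc] at this
      rwa [uIoc_of_le hst.le, Real.dist_eq]
    intro s hs t ht
    rcases lt_trichotomy s t with hst | rfl | hst
    · exact key s hs t ht hst
    · simp
    · rw [dist_comm, uIoc_comm]
      exact key t ht s hs hst
  have hIoc : uIoc 0 γ.len = Ioc 0 γ.len := uIoc_of_le γ.len_pos.le
  have hlim := tendsto_setLIntegral_zero (μ := volume.restrict (uIoc 0 γ.len))
    (f := fun τ => g (γ.toFun τ))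
    (by
      rw [hIoc, setLIntegral_congr Ioc_ae_eq_Icc]
      exact hγ.ne)
    (AbsolutelyContinuousOnInterval.tendsto_volume_restrict_totalLengthFilter_disjWithin_nhds_zero
      0 γ.len)
  have hlim' := (ENNReal.tendsto_toReal ENNReal.zero_ne_top).comp hlim
  rw [ENNReal.toReal_zero] at hlim'
  unfold AbsolutelyContinuousOnInterval
  refine squeeze_zero' (Eventually.of_forall fun E => Finset.sum_nonneg fun _ _ => dist_nonneg)
    ?_ hlim'
  have hmem : ∀ᶠ E : ℕ × (ℕ → ℝ × ℝ) in
      AbsolutelyContinuousOnInterval.totalLengthFilter ⊓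
        𝓟 (AbsolutelyContinuousOnInterval.disjWithin 0 γ.len),
      E ∈ AbsolutelyContinuousOnInterval.disjWithin 0 γ.len :=
    mem_inf_of_right (mem_principal_self _)
  filter_upwards [hmem] with E hE
  rw [Function.comp_apply]
  have hsubset := AbsolutelyContinuousOnInterval.biUnion_uIoc_subset_of_mem_disjWithin
    (n := E.1) (I := E.2) hE
  rw [Measure.restrict_restrict_of_subset hsubset]
  have hEfin : ∫⁻ τ in ⋃ i ∈ Finset.range E.1, uIoc (E.2 i).1 (E.2 i).2, g (γ.toFun τ) ≠ ∞ := by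
    refine ((lintegral_mono_set (hsubset.trans ?_)).trans_lt hγ).ne
    rw [hIoc]
    exact Ioc_subset_Icc_self
  rw [← ENNReal.ofReal_le_iff_le_toReal hEfin,
    ENNReal.ofReal_sum_of_nonneg fun _ _ => dist_nonneg,
    lintegral_biUnion_finset hE.2 fun _ _ => measurableSet_uIoc]
  refine Finset.sum_le_sum fun i hi => ?_
  have h1 := hE.1 i hi
  rw [uIcc_of_le γ.len_pos.le] at h1
  exact hbound _ h1.1 _ h1.2

end

section

variable {P : Type*} [MetricSpace P]

theorem Curve.IsAbsContAlong.congr {γ : Curve P} {u v : P → EReal} (h : γ.IsAbsContAlong v)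
    (huv : ∀ t ∈ Icc 0 γ.len, u (γ.toFun t) = v (γ.toFun t)) : γ.IsAbsContAlong u := by
  obtain ⟨f, hf, hf'⟩ := h
  exact ⟨f, fun t ht => (huv t ht).trans (hf t ht), hf'⟩

/-- Two functions that are absolutely continuous along a curve and agree at almost every time agree
at every time. -/
theorem Curve.IsAbsContAlong.eq_of_ae_eq {γ : Curve P} {u v : P → EReal}
    (hu : γ.IsAbsContAlong u) (hv : γ.IsAbsContAlong v)
    (h : ∀ᵐ t ∂volume.restrict (Icc 0 γ.len), u (γ.toFun t) = v (γ.toFun t)) :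
    ∀ t ∈ Icc 0 γ.len, u (γ.toFun t) = v (γ.toFun t) := by
  obtain ⟨f, hf, hf'⟩ := hu
  obtain ⟨k, hk, hk'⟩ := hv
  have hfc := hf'.continuousOn
  have hkc := hk'.continuousOn
  rw [uIcc_of_le γ.len_pos.le] at hfc hkc
  have hae : f =ᵐ[volume.restrict (Icc 0 γ.len)] k := by
    filter_upwards [h, ae_restrict_mem measurableSet_Icc] with t ht hmem
    rw [hf t hmem, hk t hmem] at ht
    exact_mod_cast ht
  have := Measure.eqOn_Icc_of_ae_eq volume γ.len_pos.ne hae hfc hkc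
  intro t ht
  rw [hf t ht, hk t ht, this ht]

/-- A curve that meets an open set spends a positive amount of time in it. -/
theorem Curve.exists_mem_of_ae {γ : Curve P} {W : Set P} (hW : IsOpen W)
    {t : ℝ} (ht : t ∈ Icc 0 γ.len) (htW : γ.toFun t ∈ W) {p : ℝ → Prop}
    (hp : ∀ᵐ s ∂volume.restrict (Icc 0 γ.len), p s) :
    ∃ s ∈ Icc 0 γ.len, γ.toFun s ∈ W ∧ p s := by
  obtain ⟨O, hO, htO, hsub⟩ := mem_nhdsWithin.1
    ((γ.continuousOn t ht).preimage_mem_nhdsWithin (hW.mem_nhds htW))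
  rw [← closure_Ioo γ.len_pos.ne] at ht
  have hne : (O ∩ Ioo 0 γ.len).Nonempty := mem_closure_iff.1 ht O hO htO
  have hpos : volume (O ∩ Ioo 0 γ.len) ≠ 0 :=
    ((hO.inter isOpen_Ioo).measure_pos volume hne).ne'
  rw [ae_restrict_iff' measurableSet_Icc] at hp
  obtain ⟨s, hs, hps⟩ : ∃ s ∈ O ∩ Ioo 0 γ.len, s ∈ Icc 0 γ.len → p s := by
    by_contra! hcon
    exact hpos (measure_mono_null (fun s hs => by
      have := hcon s hs
      simp only [mem_ofPred_eq]
      tauto) (ae_iff.1 hp))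
  have hs' := Ioo_subset_Icc_self hs.2
  exact ⟨s, hs', hsub ⟨hs.1, hs'⟩, hps hs'⟩

end

/-! ### The distance weighted by a density -/

section WeightedDistance

variable {P : Type*} [MetricSpace P]

/-- The arc length of a `1`-Lipschitz path is `1`-Lipschitz. -/
theorem lipschitzOnWith_variationOnFromTo {γ : ℝ → P} (hγ : LipschitzWith 1 γ) {s : Set ℝ} {a : ℝ}
    (ha : a ∈ s) : LipschitzOnWith 1 (variationOnFromTo γ s a) s := by
  have hbv := hγ.locallyBoundedVariationOn s
  refine LipschitzOnWith.of_dist_le_mul fun x hx y hy => ?_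
  have key : ∀ x ∈ s, ∀ y ∈ s, x ≤ y →
      dist (variationOnFromTo γ s a x) (variationOnFromTo γ s a y) ≤ dist x y := by
    intro x hx y hy hxy
    rw [dist_comm, dist_comm x, Real.dist_eq, Real.dist_eq, abs_of_nonneg (sub_nonneg.2 hxy),
      abs_of_nonneg (sub_nonneg.2 (variationOnFromTo.monotoneOn hbv ha hx hy hxy)),
      ← variationOnFromTo.add hbv ha hx hy, add_sub_cancel_left,
      variationOnFromTo.eq_of_le _ _ hxy]
    refine ENNReal.toReal_le_of_le_ofReal (sub_nonneg.2 hxy) ?_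
    have h1 := (hγ.lipschitzOnWith (s := univ)).comp_eVariationOn_le (g := fun t : ℝ => t)
      (s := s ∩ Icc x y) (mapsTo_univ _ _)
    rw [ENNReal.coe_one, one_mul] at h1
    exact h1.trans_eq ((monotoneOn_id.mono (subset_univ _)).eVariationOn_eq hx hy)
  rw [NNReal.coe_one, one_mul]
  rcases le_total x y with h | h
  · exact key x hx y hy h
  · rw [dist_comm, dist_comm x]
    exact key y hy x hx h

/-- A non-closed `1`-Lipschitz path has an arc length parametrization, and passing to it does not
increase line integrals, since the arc length is a `1`-Lipschitz function of time. -/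
theorem exists_curve_lineIntegral_le {γ : ℝ → P} (hγ : LipschitzWith 1 γ) {T : ℝ} (hT : 0 ≤ T)
    (hne : γ 0 ≠ γ T) :
    ∃ c : Curve P, c.toFun 0 = γ 0 ∧
      ∀ ρ : P → ℝ≥0∞, c.lineIntegral ρ ≤ ∫⁻ t in Icc 0 T, ρ (γ t) := by
  set s := Icc 0 T with hs
  have h0 : (0 : ℝ) ∈ s := left_mem_Icc.2 hT
  have hTs : T ∈ s := right_mem_Icc.2 hT
  have hbv := hγ.locallyBoundedVariationOn s
  set v := variationOnFromTo γ s 0 with hv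
  have hv0 : v 0 = 0 := variationOnFromTo.self _ _ _
  have hlip : LipschitzOnWith 1 v s := lipschitzOnWith_variationOnFromTo hγ h0
  have hmono : MonotoneOn v s := variationOnFromTo.monotoneOn hbv h0
  have himage : v '' s = Icc 0 (v T) := by
    refine Subset.antisymm ?_ ?_
    · rintro _ ⟨t, ht, rfl⟩
      exact ⟨hv0 ▸ hmono h0 ht ht.1, hmono ht hTs ht.2⟩
    · have := intermediate_value_Icc hT hlip.continuousOn
      rwa [hv0] at this
  have heq : ∀ t ∈ s, naturalParameterization γ s 0 (v t) = γ t := fun t ht =>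
    edist_eq_zero.1 (edist_naturalParameterization_eq_zero hbv h0 ht)
  have hpos : 0 < v T := by
    refine lt_of_le_of_ne (hv0 ▸ hmono h0 hTs hT) fun h => hne ?_
    rw [← heq 0 h0, ← heq T hTs, hv0, ← h]
  refine ⟨⟨v T, hpos, naturalParameterization γ s 0, ?_⟩, ?_, fun ρ => ?_⟩
  · rw [← himage]
    exact has_unit_speed_naturalParameterization γ hbv h0
  · have := heq 0 h0
    rwa [hv0] at this
  · -- the arc length `v` pushes Lebesgue measure on `[0, T]` to a measure that dominates Lebesgue
    -- measure on its image
    have hmeas : volume.restrict (Icc 0 (v T)) ≤ Measure.map v (volume.restrict s) := by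
      refine Measure.le_iff.2 fun A hA => ?_
      have hvm : AEMeasurable v (volume.restrict s) :=
        hlip.continuousOn.aemeasurable measurableSet_Icc
      rw [Measure.restrict_apply hA, Measure.map_apply_of_aemeasurable hvm hA,
        Measure.restrict_apply' measurableSet_Icc, ← himage, inter_comm A,
        ← image_inter_preimage, inter_comm, ← hausdorffMeasure_real]
      simpa using (hlip.mono inter_subset_right).hausdorffMeasure_image_le
        (s := v ⁻¹' A ∩ s) zero_le_one
    calc ∫⁻ τ in Icc 0 (v T), ρ (naturalParameterization γ s 0 τ)
        ≤ ∫⁻ τ, ρ (naturalParameterization γ s 0 τ) ∂Measure.map v (volume.restrict s) :=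
          lintegral_mono' hmeas le_rfl
      _ ≤ ∫⁻ t in s, ρ (naturalParameterization γ s 0 (v t)) := lintegral_map_le _ _
      _ = ∫⁻ t in s, ρ (γ t) :=
          setLIntegral_congr_fun measurableSet_Icc fun t ht => by rw [heq t ht]

/-- The least cost, measured by the density `g`, of a `1`-Lipschitz path that starts at `x` and
runs forever. If `g` vanishes outside `V` and is at least `1` on `V`, then this is the least cost
of leaving `V`. -/
def escapeCost (g : P → ℝ≥0∞) (x : P) : ℝ≥0∞ :=
  ⨅ (γ : ℝ → P) (_ : LipschitzWith 1 γ) (_ : γ 0 = x), ∫⁻ t in Ici (0 : ℝ), g (γ t)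

theorem escapeCost_le (g : P → ℝ≥0∞) {γ : ℝ → P} (hγ : LipschitzWith 1 γ) :
    escapeCost g (γ 0) ≤ ∫⁻ t in Ici (0 : ℝ), g (γ t) :=
  iInf_le_of_le γ <| iInf_le_of_le hγ <| iInf_le_of_le rfl le_rfl

theorem exists_of_escapeCost_lt {g : P → ℝ≥0∞} {x : P} {r : ℝ≥0∞} (h : escapeCost g x < r) :
    ∃ γ : ℝ → P, LipschitzWith 1 γ ∧ γ 0 = x ∧ ∫⁻ t in Ici (0 : ℝ), g (γ t) < r := by
  simp only [escapeCost, iInf_lt_iff] at h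
  obtain ⟨γ, h1, h2, h3⟩ := h
  exact ⟨γ, h1, h2, h3⟩

theorem escapeCost_eq_zero {g : P → ℝ≥0∞} {x : P} (h : g x = 0) : escapeCost g x = 0 := by
  refine le_antisymm ?_ bot_le
  simpa [h] using escapeCost_le g (LipschitzWith.const' (α := ℝ) (K := 1) x)

/-- Following a path for a while before escaping. -/
theorem escapeCost_le_add (g : P → ℝ≥0∞) {γ : ℝ → P} (hγ : LipschitzWith 1 γ) {l : ℝ}
    (hl : 0 ≤ l) : escapeCost g (γ 0) ≤ escapeCost g (γ l) + ∫⁻ t in Icc 0 l, g (γ t) := by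
  rw [← tsub_le_iff_right]
  refine le_iInf fun η => le_iInf fun hη => le_iInf fun hη0 => ?_
  rw [tsub_le_iff_right]
  -- the concatenation of `γ` on `[0, l]` with a path `η` that starts at `γ l`
  set σ : ℝ → P := fun t => if t ≤ l then γ t else η (t - l) with hσ
  have key : ∀ s t, s ≤ t → dist (σ s) (σ t) ≤ dist s t := by
    intro s t hst
    have hd : dist s t = t - s := by rw [dist_comm, Real.dist_eq, abs_of_nonneg (by linarith)]
    by_cases ht : t ≤ l
    · simpa [hσ, ht, hst.trans ht] using hγ.dist_le_mul s t
    · by_cases hs : s ≤ l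
      · have h1 := hγ.dist_le_mul s l
        have h2 := hη.dist_le_mul 0 (t - l)
        rw [hη0] at h2
        simp only [NNReal.coe_one, one_mul, dist_comm s, dist_comm (0 : ℝ), Real.dist_eq, sub_zero,
          abs_of_nonneg (sub_nonneg.2 hs), abs_of_nonneg (sub_nonneg.2 (not_le.1 ht).le)] at h1 h2
        simp only [hσ, ht, hs, if_true, if_false]
        linarith [dist_triangle (γ s) (γ l) (η (t - l))]
      · simpa [hσ, ht, hs] using hη.dist_le_mul (s - l) (t - l)
  have hσL : LipschitzWith 1 σ := LipschitzWith.of_dist_le_mul fun s t => by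
    rw [NNReal.coe_one, one_mul]
    rcases le_total s t with h | h
    · exact key s t h
    · rw [dist_comm, dist_comm s]
      exact key t s h
  have hσ0 : σ 0 = γ 0 := by simp [hσ, hl]
  have h := escapeCost_le g hσL
  rw [hσ0] at h
  refine h.trans ?_
  have hsplit : ∫⁻ t in Ici (0 : ℝ), g (σ t)
      = (∫⁻ t in Ioi l, g (σ t)) + ∫⁻ t in Icc 0 l, g (σ t) := by
    rw [← Icc_union_Ioi_eq_Ici hl, lintegral_union measurableSet_Ioi
      (disjoint_left.2 fun t ht ht' => absurd ht.2 (not_le.2 ht')), add_comm]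
  rw [hsplit]
  gcongr ?_ + ?_
  · have htr := (measurePreserving_sub_right (volume : Measure ℝ) l).setLIntegral_comp_preimage_emb
      (measurableEmbedding_subRight l) (fun τ => g (η τ)) (Ioi 0)
    rw [setLIntegral_congr Ioi_ae_eq_Ici.symm, ← htr]
    rw [preimage_sub_const_Ioi, zero_add]
    refine (setLIntegral_congr_fun measurableSet_Ioi fun t ht => ?_).le
    simp only [hσ, if_neg (not_le.2 (mem_Ioi.1 ht))]
  · refine (setLIntegral_congr_fun measurableSet_Icc fun t ht => ?_).le
    simp only [hσ, if_pos ht.2]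

/-- The density is a gradient bound for the escape cost; the second inequality follows from the
first one applied to the reversed curve. -/
theorem isGradientBound_escapeCost [MeasurableSpace P] {g : P → ℝ≥0∞} (hg : Measurable g) :
    IsGradientBound g (escapeCost g) := by
  have hext : ∀ c : Curve P, ∃ σ : ℝ → P, LipschitzWith 1 σ ∧
      ∀ t ∈ Icc 0 c.len, σ t = c.toFun t := by
    intro c
    refine ⟨fun t => c.toFun (projIcc 0 c.len c.len_pos.le t), ?_, fun t ht => ?_⟩
    · have h1 := (lipschitzOnWith_iff_restrict.1 c.lipschitzOnWith).comp
        (LipschitzWith.projIcc c.len_pos.le)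
      rw [one_mul] at h1
      exact h1
    · simp only [projIcc_of_mem c.len_pos.le ht]
  refine ⟨hg, fun c => ?_, fun c => ?_⟩ <;> obtain ⟨σ, hσ, heq⟩ := hext c
  · have h := escapeCost_le_add g hσ c.len_pos.le
    rw [heq _ (left_mem_Icc.2 c.len_pos.le), heq _ (right_mem_Icc.2 c.len_pos.le)] at h
    refine h.trans_eq ?_
    congr 1
    exact setLIntegral_congr_fun measurableSet_Icc fun t ht => by simp only [heq t ht]
  · have hσ' : LipschitzWith 1 fun t => σ (c.len - t) := LipschitzWith.of_dist_le_mul fun s t => by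
      simpa only [dist_sub_left] using hσ.dist_le_mul (c.len - s) (c.len - t)
    have h := escapeCost_le_add g hσ' c.len_pos.le
    simp only [sub_zero, sub_self] at h
    rw [heq _ (left_mem_Icc.2 c.len_pos.le), heq _ (right_mem_Icc.2 c.len_pos.le)] at h
    refine h.trans_eq ?_
    congr 1
    have href := (Measure.measurePreserving_sub_left (volume : Measure ℝ)
      c.len).setLIntegral_comp_preimage_emb
      (measurableEmbedding_subLeft c.len) (fun τ => g (σ τ)) (Icc 0 c.len)
    rw [preimage_const_sub_Icc, sub_self, sub_zero] at href
    rw [href]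
    exact setLIntegral_congr_fun measurableSet_Icc fun t ht => by simp only [heq t ht]

/-- A path of cost less than `1` leaves `V` before time `1`. -/
theorem exists_exit_time {V : Set P} (hV : IsOpen V) {g : P → ℝ≥0∞} (hg1 : ∀ x ∈ V, 1 ≤ g x)
    {γ : ℝ → P} (hγ : LipschitzWith 1 γ) (hcost : ∫⁻ t in Ici (0 : ℝ), g (γ t) < 1) :
    ∃ T ∈ Icc (0 : ℝ) 1, γ T ∉ V ∧ ∀ t ∈ Ico 0 T, γ t ∈ V := by
  have hbound : ∀ l : ℝ, 0 ≤ l → (∀ t ∈ Ico 0 l, γ t ∈ V) → l ≤ 1 := by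
    intro l hl hmem
    have : ENNReal.ofReal l < 1 := by
      refine lt_of_le_of_lt ?_ hcost
      calc ENNReal.ofReal l = ∫⁻ _ in Ico 0 l, (1 : ℝ≥0∞) := by simp
        _ ≤ ∫⁻ t in Ico 0 l, g (γ t) :=
          setLIntegral_mono' measurableSet_Ico fun t ht => hg1 _ (hmem t ht)
        _ ≤ _ := lintegral_mono_set Ico_subset_Ici_self
    exact (ENNReal.ofReal_lt_one.1 this).le
  set S := {t : ℝ | 0 ≤ t ∧ γ t ∉ V} with hS
  have hSne : S.Nonempty := by
    by_contra hne
    have : ∀ t, 0 ≤ t → γ t ∈ V := by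
      intro t ht
      by_contra hmem
      exact hne ⟨t, ht, hmem⟩
    linarith [hbound 2 (by norm_num) fun t ht => this t ht.1]
  have hSc : IsClosed S := isClosed_Ici.inter (hV.isClosed_compl.preimage hγ.continuous)
  have hSb : BddBelow S := ⟨0, fun t ht => ht.1⟩
  have hmem := hSc.csInf_mem hSne hSb
  have hlt : ∀ t ∈ Ico 0 (sInf S), γ t ∈ V := by
    intro t ht
    by_contra h
    exact absurd (csInf_le hSb ⟨ht.1, h⟩) (not_le.2 ht.2)
  exact ⟨sInf S, ⟨hmem.1, hbound _ hmem.1 hlt⟩, hmem.2, hlt⟩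

/-- If `z` is a point of `V` such that every curve starting at `z` has `ρ`-length at least `1`,
then escaping from `V` costs at least `1`. -/
theorem one_le_escapeCost {V : Set P} (hV : IsOpen V) {g ρ : P → ℝ≥0∞} (hg1 : ∀ x ∈ V, 1 ≤ g x)
    (hρ : ∀ x ∈ V, ρ x ≤ g x) {z : P} (hz : z ∈ V)
    (hcurve : ∀ c : Curve P, c.toFun 0 = z → 1 ≤ c.lineIntegral ρ) : 1 ≤ escapeCost g z := by
  by_contra! hlt
  obtain ⟨γ, hγ, rfl, hcost⟩ := exists_of_escapeCost_lt hlt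
  obtain ⟨T, hT, hTV, hTin⟩ := exists_exit_time hV hg1 hγ hcost
  obtain ⟨c, hc0, hc⟩ := exists_curve_lineIntegral_le hγ hT.1 fun h => hTV (h ▸ hz)
  refine absurd hcost (not_lt.2 ((hcurve c hc0).trans ((hc ρ).trans ?_)))
  rw [← setLIntegral_congr Ico_ae_eq_Icc]
  exact (setLIntegral_mono' measurableSet_Ico fun t ht => hρ _ (hTin t ht)).trans
    (lintegral_mono_set Ico_subset_Ici_self)

/-- A sequence of `1`-Lipschitz paths in a compact set that are at rest after time `1` has a
subsequence that converges at all nonnegative times to a `1`-Lipschitz path. -/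
theorem exists_subseq_tendsto_path {K : Set P} (hK : IsCompact K) {γ : ℕ → ℝ → P}
    (hγ : ∀ n, LipschitzWith 1 (γ n)) (hγK : ∀ n, ∀ t ∈ Icc (0 : ℝ) 1, γ n t ∈ K)
    (hrest : ∀ n t, 1 ≤ t → γ n t = γ n 1) :
    ∃ (σ : ℝ → P) (φ : ℕ → ℕ), LipschitzWith 1 σ ∧ StrictMono φ ∧
      ∀ t, 0 ≤ t → Tendsto (fun k => γ (φ k) t) atTop (𝓝 (σ t)) := by
  let F : ℕ → BoundedContinuousFunction (Icc (0 : ℝ) 1) P := fun n =>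
    BoundedContinuousFunction.mkOfCompact ⟨fun t => γ n t, (hγ n).continuous.comp
      continuous_subtype_val⟩
  have hcomp : IsCompact (closure (range F)) := by
    refine BoundedContinuousFunction.arzela_ascoli K hK _ ?_ ?_
    · rintro _ t ⟨n, rfl⟩
      exact hγK n t t.2
    · refine (LipschitzWith.uniformEquicontinuous _ 1 ?_).equicontinuous
      rintro ⟨_, n, rfl⟩
      exact fun s t => hγ n s t
  obtain ⟨G, -, φ, hφ, hlim⟩ := hcomp.tendsto_subseq fun n => subset_closure (mem_range_self n)
  have hpt : ∀ t : Icc (0 : ℝ) 1, Tendsto (fun k => γ (φ k) t) atTop (𝓝 (G t)) := fun t =>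
    ((continuous_eval_const (F := BoundedContinuousFunction (Icc (0 : ℝ) 1) P) t).tendsto G).comp
      hlim
  refine ⟨fun t => G (projIcc 0 1 zero_le_one t), φ, ?_, hφ, fun t ht => ?_⟩
  · have hG : LipschitzWith 1 G := fun s t =>
      le_of_tendsto ((hpt s).edist (hpt t)) (Eventually.of_forall fun k => hγ (φ k) s t)
    have := hG.comp (LipschitzWith.projIcc (zero_le_one (α := ℝ)))
    rwa [one_mul] at this
  · simp only
    rcases le_total t 1 with h1 | h1
    · rw [projIcc_of_mem zero_le_one ⟨ht, h1⟩]
      exact hpt ⟨t, ht, h1⟩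
    · simp only [fun k => hrest (φ k) t h1]
      rw [projIcc_of_right_le zero_le_one h1]
      exact hpt ⟨1, _⟩

/-- Truncated at `1`, the cost of escaping from a relatively compact open set is lower
semicontinuous: paths of bounded cost may be stopped when they leave `V`, and then they
subconverge; Fatou's lemma bounds the cost of the limit. -/
theorem lowerSemicontinuous_min_escapeCost [MeasurableSpace P] [BorelSpace P] {V : Set P}
    (hV : IsOpen V) (hK : IsCompact (closure V)) {g : P → ℝ≥0∞} (hg : LowerSemicontinuous g)
    (hg0 : ∀ x ∉ V, g x = 0) (hg1 : ∀ x ∈ V, 1 ≤ g x) :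
    LowerSemicontinuous fun x => min 1 (escapeCost g x) := by
  rw [lowerSemicontinuous_iff_isClosed_preimage]
  intro y
  rcases le_or_gt 1 y with hy | hy
  · convert isClosed_univ
    ext x
    simp [hy]
  have hpre : (fun x => min 1 (escapeCost g x)) ⁻¹' Iic y = {x | escapeCost g x ≤ y} := by
    ext x
    simp [hy]
  rw [hpre]
  refine isClosed_of_closure_subset fun x hx => ?_
  by_cases hxV : x ∉ V
  · simp [escapeCost_eq_zero (hg0 x hxV)]
  rw [not_not] at hxV
  obtain ⟨z, hz, hzx⟩ := mem_closure_iff_seq_limit.1 (hV.inter_closure ⟨hxV, hx⟩)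
  -- a bound `r < 1` on the cost forces the exit time to be at most `1`
  refine le_of_forall_gt_imp_ge_of_dense (α := ℝ≥0∞) fun r hr => ?_
  wlog hr1 : r < 1 generalizing r
  · obtain ⟨r', h1, h2⟩ := exists_between hy
    exact (this r' h1 h2).trans (h2.le.trans (not_lt.1 hr1))
  have hpath : ∀ n, ∃ γ : ℝ → P, LipschitzWith 1 γ ∧ γ 0 = z n ∧
      (∀ t ∈ Icc (0 : ℝ) 1, γ t ∈ closure V) ∧ (∀ t, 1 ≤ t → γ t = γ 1) ∧
      ∫⁻ t in Ici (0 : ℝ), g (γ t) ≤ r := by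
    intro n
    obtain ⟨γ, hγ, hγ0, hcost⟩ := exists_of_escapeCost_lt (lt_of_le_of_lt (hz n).2 hr)
    obtain ⟨T, hT, hTV, hTin⟩ := exists_exit_time hV hg1 hγ (hcost.trans hr1)
    -- stopping the path at its exit time `T` keeps it in `closure V` and does not raise the cost
    have hT0 : 0 ≠ T := by
      rintro rfl
      exact hTV (hγ0 ▸ (hz n).1)
    have hcl : ∀ t ∈ Icc 0 T, γ t ∈ closure V := by
      intro t ht
      rw [← closure_Ico hT0] at ht
      exact map_mem_closure hγ.continuous ht hTin
    refine ⟨fun t => γ (min t T), ?_, ?_, fun t ht => ?_, fun t ht => ?_, ?_⟩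
    · have := hγ.comp (LipschitzWith.id.min_const T)
      rwa [one_mul] at this
    · simp [min_eq_left hT.1, hγ0]
    · exact hcl _ ⟨le_min ht.1 hT.1, min_le_right _ _⟩
    · simp [min_eq_right hT.2, min_eq_right (hT.2.trans ht)]
    · refine (lintegral_mono fun t => ?_).trans hcost.le
      rcases le_total t T with h | h
      · simp [min_eq_left h]
      · simp [min_eq_right h, hg0 _ hTV]
  choose γ hγ hγ0 hγK hrest hcost using hpath
  obtain ⟨σ, φ, hσ, hφ, hlim⟩ := exists_subseq_tendsto_path hK hγ hγK hrest
  have hσ0 : σ 0 = x := by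
    refine tendsto_nhds_unique (hlim 0 le_rfl) ?_
    simp only [hγ0]
    exact hzx.comp hφ.tendsto_atTop
  rw [← hσ0]
  calc escapeCost g (σ 0) ≤ ∫⁻ t in Ici (0 : ℝ), g (σ t) := escapeCost_le g hσ
    _ ≤ ∫⁻ t in Ici (0 : ℝ), liminf (fun k => g (γ (φ k) t)) atTop :=
      setLIntegral_mono' measurableSet_Ici fun t ht =>
        (hg.lowerSemicontinuousAt _).le_liminf.trans ((hlim t ht).liminf_le_liminf_comp)
    _ ≤ liminf (fun k => ∫⁻ t in Ici (0 : ℝ), g (γ (φ k) t)) atTop :=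
      lintegral_liminf_le fun k => hg.measurable.comp (hγ (φ k)).continuous.measurable
    _ ≤ r := by
      refine liminf_le_of_le (by isBoundedDefault) fun b hb => ?_
      obtain ⟨k, hk⟩ := hb.exists
      exact hk.trans (hcost _)

end WeightedDistance

/-! ### Separability of the space -/

/-- A metric space with a `σ`-finite measure that is positive on balls is second countable, since a
disjoint family of balls is countable. -/
theorem secondCountableTopology_of_measure_ball_pos {P : Type*} [MetricSpace P]
    [MeasurableSpace P] [BorelSpace P] (μ : Measure P) [SigmaFinite μ]
    (hball : ∀ (x : P) (r : ℝ), 0 < r → 0 < μ (Metric.ball x r)) :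
    SecondCountableTopology P := by
  refine Metric.secondCountable_of_almost_dense_set fun ε hε => ?_
  obtain ⟨s, hs⟩ := zorn_subset {s : Set P | s.Pairwise fun x y => ε ≤ dist x y} (by
    intro c hc hchain
    exact ⟨⋃₀ c, (pairwise_sUnion hchain.directedOn).2 fun t ht => hc ht,
      fun t ht => subset_sUnion_of_mem ht⟩)
  refine ⟨s, ?_, fun x => ?_⟩
  · have hdisj : Pairwise (Function.onFun Disjoint fun x : s => Metric.ball (x : P) (ε / 2)) := by
      intro x y hxy
      refine Metric.ball_disjoint_ball ?_
      have := hs.prop x.2 y.2 fun h => hxy (Subtype.ext h)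
      linarith
    have := Measure.countable_meas_pos_of_disjoint_iUnion (μ := μ)
      (fun x : s => Metric.isOpen_ball.measurableSet) hdisj
    rw [show {x : s | 0 < μ (Metric.ball (x : P) (ε / 2))} = univ from
      eq_univ_of_forall fun x => hball x _ (half_pos hε)] at this
    exact countable_coe_iff.1 (countable_univ_iff.1 this)
  · by_contra! hx
    have hins : insert x s ∈ {s : Set P | s.Pairwise fun x y => ε ≤ dist x y} := by
      refine hs.prop.insert fun y hy _ => ⟨(hx y hy).le, ?_⟩
      rw [dist_comm]
      exact (hx y hy).le
    have hxs : x ∈ s := hs.le_of_ge hins (subset_insert x s) (mem_insert x s)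
    have := hx x hxs
    rw [dist_self] at this
    linarith

/-! ### Lower semicontinuous majorants -/

namespace QuasiBanachFunctionLattice

variable {P : Type*} [MetricSpace P] [MeasurableSpace P] {μ : Measure P}
  (X : QuasiBanachFunctionLattice μ)

/-- A quantitatively weak form of the Vitali–Carathéodory property, which loses the modulus of
concavity: Borel functions have lower semicontinuous majorants of comparable quasi-norm. -/
def HasLscMajorants : Prop :=
  ∀ ρ : P → ℝ≥0∞, Measurable ρ → ∀ ε : ℝ≥0∞, 0 < ε →
    ∃ σ : P → ℝ≥0∞, LowerSemicontinuous σ ∧ (∀ x, ρ x ≤ σ x) ∧ X.eNorm σ ≤ X.c * (X.eNorm ρ + ε)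

variable {X}

theorem VitaliCaratheodory.hasLscMajorants (h : X.VitaliCaratheodory) : X.HasLscMajorants := by
  intro ρ hρ ε hε
  rcases eq_or_ne (X.eNorm ρ) ∞ with hinf | hfin
  · refine ⟨fun _ => ∞, lowerSemicontinuous_const, fun _ => le_top, ?_⟩
    rw [hinf, top_add, ENNReal.mul_top (zero_lt_one.trans_le X.one_le_coe_c).ne']
    exact le_top
  have hlt := ENNReal.lt_add_right hfin hε.ne'
  have hvc := h (fun x => (ρ x : EReal)) hρ.aemeasurable.coe_ereal_ennreal
  rw [← eNorm] at hvc
  nth_rw 1 [hvc] at hlt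
  simp only [iInf_lt_iff] at hlt
  obtain ⟨v, hv, hge, hvε⟩ := hlt
  have hge' : ∀ x, (ρ x : EReal) ≤ v x := fun x => by simpa [abs_coe_ennreal] using hge x
  have hcoe : ∀ x, ((v x).toENNReal : EReal) = v x := fun x =>
    EReal.coe_toENNReal ((EReal.coe_ennreal_nonneg _).trans (hge' x))
  refine ⟨fun x => (v x).toENNReal, EReal.continuous_toENNReal.comp_lowerSemicontinuous hv
    fun a b hab => EReal.toENNReal_le_toENNReal hab, fun x => ?_, ?_⟩
  · rw [← EReal.coe_ennreal_le_coe_ennreal_iff, hcoe]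
    exact hge' x
  · rw [eNorm]
    simp only [hcoe]
    exact hvε.le.trans (le_mul_of_one_le_left bot_le X.one_le_coe_c)

variable [BorelSpace P]

/-- If bounded sets have absolutely continuous quasi-norm, then bounded Borel sets are, in
quasi-norm, outer regular. -/
theorem BoundedSetsAbsCont.exists_isOpen_eNorm_diff_lt_of_isBounded [μ.OuterRegular]
    (hfin : ∀ (x : P) (r : ℝ), 0 < r → μ (Metric.ball x r) < ∞) (h : X.BoundedSetsAbsCont)
    {A : Set P} (hA : MeasurableSet A) (hb : Bornology.IsBounded A) {ε : ℝ≥0∞} (hε : 0 < ε) :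
    ∃ U, IsOpen U ∧ A ⊆ U ∧ X.eNorm ((U \ A).indicator 1) < ε := by
  rcases isEmpty_or_nonempty P with hP | ⟨⟨x₀⟩⟩
  · refine ⟨univ, isOpen_univ, subset_univ _, ?_⟩
    rwa [X.eNorm_eq_zero (Eventually.of_forall fun x => (hP.false x).elim)]
  obtain ⟨r, hr0, hr⟩ := hb.subset_ball_lt 0 x₀
  set B := Metric.ball x₀ r
  have hμA : μ A ≠ ∞ := ((measure_mono hr).trans_lt (hfin x₀ r hr0)).ne
  have hU : ∀ n : ℕ, ∃ U, A ⊆ U ∧ IsOpen U ∧ μ U < μ A + ((n : ℝ≥0∞) + 1)⁻¹ := fun n => by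
    obtain ⟨U, h1, h2, h3⟩ := A.exists_isOpen_lt_add hμA (μ := μ) (ε := ((n : ℝ≥0∞) + 1)⁻¹)
      (ENNReal.inv_ne_zero.2 (by finiteness))
    exact ⟨U, h1, h2, h3⟩
  choose U hAU hUo hUμ using hU
  -- finite intersections make the sequence decreasing, the ball keeps it bounded
  let W : ℕ → Set P := fun n => (⋂ k ∈ Iic n, U k) ∩ B
  have hWo : ∀ n, IsOpen (W n) := fun n =>
    ((finite_Iic n).isOpen_biInter fun k _ => hUo k).inter Metric.isOpen_ball
  have hAW : ∀ n, A ⊆ W n := fun n => subset_inter (subset_iInter₂ fun k _ => hAU k) hr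
  have hanti : Antitone fun n => W n \ A := fun m n hmn =>
    sdiff_subset_sdiff_left (inter_subset_inter_left _
      (biInter_subset_biInter_left (Iic_subset_Iic.2 hmn)))
  have hle : ∀ n, μ (W n \ A) ≤ ((n : ℝ≥0∞) + 1)⁻¹ := by
    intro n
    rw [measure_sdiff (hAW n) hA.nullMeasurableSet hμA, tsub_le_iff_left]
    refine (measure_mono ?_).trans (hUμ n).le
    exact inter_subset_left.trans (biInter_subset_of_mem (mem_Iic.2 le_rfl))
  have hnull : μ (⋂ n, W n \ A) = 0 := by
    have hlim : Tendsto (fun n : ℕ => ((n : ℝ≥0∞) + 1)⁻¹) atTop (𝓝 0) := by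
      simpa using (tendsto_add_atTop_iff_nat 1).2 ENNReal.tendsto_inv_nat_nhds_zero
    exact le_antisymm (ge_of_tendsto' hlim fun n =>
      (measure_mono (iInter_subset _ n)).trans (hle n)) bot_le
  have hlim := (h B Metric.isBounded_ball Metric.isOpen_ball.nullMeasurableSet).2 _
    (fun n => ((hWo n).measurableSet.diff hA).nullMeasurableSet) hanti hnull
  obtain ⟨n, hn⟩ := (hlim.eventually (gt_mem_nhds hε)).exists
  refine ⟨W n, hWo n, hAW n, ?_⟩
  have heq : (fun x => (((W n \ A).indicator 1 x : ℝ≥0∞) : EReal))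
      = (W n \ A).indicator (B.indicator 1) := ?_
  · rwa [eNorm, heq]
  ext x
  by_cases hx : x ∈ W n \ A
  · have hxB : x ∈ B := hx.1.2
    simp [hx, hxB]
  · simp [hx]

/-- Outer regularity in quasi-norm for all Borel sets, by exhaustion with balls. -/
theorem BoundedSetsAbsCont.exists_isOpen_eNorm_diff_lt [μ.OuterRegular]
    (hfin : ∀ (x : P) (r : ℝ), 0 < r → μ (Metric.ball x r) < ∞) (h : X.BoundedSetsAbsCont)
    {A : Set P} (hA : MeasurableSet A) {ε : ℝ≥0∞} (hε : 0 < ε) :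
    ∃ U, IsOpen U ∧ A ⊆ U ∧ X.eNorm ((U \ A).indicator 1) < ε := by
  rcases isEmpty_or_nonempty P with hP | ⟨⟨x₀⟩⟩
  · refine ⟨univ, isOpen_univ, subset_univ _, ?_⟩
    rwa [X.eNorm_eq_zero (Eventually.of_forall fun x => (hP.false x).elim)]
  obtain ⟨δ, hδ, hsum⟩ := exists_pos_tsum_mul_pow_lt X.c X.one_le_c hε
  have hAn : ∀ n : ℕ, MeasurableSet (A ∩ Metric.ball x₀ n) := fun n =>
    hA.inter Metric.isOpen_ball.measurableSet
  choose U hUo hAU hUδ using fun n : ℕ => h.exists_isOpen_eNorm_diff_lt_of_isBounded hfin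
    (hAn n) (Metric.isBounded_ball.subset inter_subset_right) (hδ n)
  refine ⟨⋃ n, U n, isOpen_iUnion hUo, fun x hx => ?_, ?_⟩
  · obtain ⟨n, hn⟩ := exists_nat_gt (dist x x₀)
    exact mem_iUnion.2 ⟨n, hAU n ⟨hx, hn⟩⟩
  have hm : ∀ n, Measurable ((U n \ (A ∩ Metric.ball x₀ n)).indicator (1 : P → ℝ≥0∞)) := fun n =>
    measurable_one.indicator ((hUo n).measurableSet.diff (hAn n))
  refine lt_of_le_of_lt (X.eNorm_mono (σ := fun x => ∑' n,
    (U n \ (A ∩ Metric.ball x₀ n)).indicator 1 x) ?_ (Measurable.tsum hm).aemeasurable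
    fun x => ?_) <| lt_of_le_of_lt ((X.eNorm_tsum_le fun n => (hm n).aemeasurable).trans
      (ENNReal.tsum_le_tsum fun n => ?_)) hsum
  · exact (measurable_one.indicator
      ((isOpen_iUnion hUo).measurableSet.diff hA)).aemeasurable
  · by_cases hx : x ∈ (⋃ n, U n) \ A
    · obtain ⟨n, hn⟩ := mem_iUnion.1 hx.1
      refine le_trans ?_ (ENNReal.le_tsum n)
      have hx' : x ∈ U n \ (A ∩ Metric.ball x₀ n) := ⟨hn, fun h' => hx.2 h'.1⟩
      rw [indicator_of_mem hx, indicator_of_mem hx']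
    · simp [hx]
  · gcongr
    exact (hUδ n).le

/-- Simple functions have lower semicontinuous majorants with an excess of small quasi-norm. The
excess is recorded as a separate function `e` because the quasi-norm is only quasi-additive. -/
theorem BoundedSetsAbsCont.exists_lsc_simpleFunc [μ.OuterRegular]
    (hfin : ∀ (x : P) (r : ℝ), 0 < r → μ (Metric.ball x r) < ∞) (h : X.BoundedSetsAbsCont)
    (f : SimpleFunc P ℝ≥0) : ∀ ε : ℝ≥0∞, 0 < ε →
    ∃ σ e : P → ℝ≥0∞, LowerSemicontinuous σ ∧ Measurable e ∧ (∀ x, f x ≤ σ x) ∧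
      (∀ x, σ x ≤ f x + e x) ∧ X.eNorm e < ε := by
  induction f using SimpleFunc.induction with
  | @const a s hs =>
    intro ε hε
    obtain ⟨δ, hδ, hδε⟩ := ENNReal.exists_nnreal_pos_mul_lt (a := (a : ℝ≥0∞)) (by finiteness)
      hε.ne'
    obtain ⟨U, hU, hsU, hUδ⟩ := h.exists_isOpen_eNorm_diff_lt hfin hs
      (ε := δ) (by exact_mod_cast hδ)
    have hm : Measurable ((U \ s).indicator (1 : P → ℝ≥0∞)) :=
      measurable_one.indicator (hU.measurableSet.diff hs)
    refine ⟨U.indicator fun _ => a, fun x => a * (U \ s).indicator 1 x,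
      hU.lowerSemicontinuous_indicator bot_le, hm.const_mul _, fun x => ?_, fun x => ?_, ?_⟩
    · by_cases hx : x ∈ s
      · simp [hx, hsU hx]
      · simp [hx]
    · by_cases hx : x ∈ s
      · simp [hx, hsU hx]
      · by_cases hxU : x ∈ U <;> simp [hx, hxU]
    · rw [X.eNorm_const_mul a hm.aemeasurable]
      refine lt_of_le_of_lt ?_ hδε
      rw [mul_comm]
      gcongr
  | @add f₁ f₂ _ h₁ h₂ =>
    intro ε hε
    have hc0 : (X.c : ℝ≥0∞) ≠ 0 := (zero_lt_one.trans_le X.one_le_coe_c).ne'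
    obtain ⟨δ, hδ, hδε⟩ := ENNReal.exists_nnreal_pos_mul_lt (a := (X.c : ℝ≥0∞) * 2)
      (by finiteness) hε.ne'
    obtain ⟨σ₁, e₁, hσ₁, he₁, hle₁, hge₁, hn₁⟩ := h₁ δ (by exact_mod_cast hδ)
    obtain ⟨σ₂, e₂, hσ₂, he₂, hle₂, hge₂, hn₂⟩ := h₂ δ (by exact_mod_cast hδ)
    refine ⟨fun x => σ₁ x + σ₂ x, fun x => e₁ x + e₂ x, hσ₁.add hσ₂, he₁.add he₂, fun x => ?_,
      fun x => ?_, ?_⟩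
    · simp only [SimpleFunc.coe_add, Pi.add_apply, ENNReal.coe_add]
      exact add_le_add (hle₁ x) (hle₂ x)
    · simp only [SimpleFunc.coe_add, Pi.add_apply, ENNReal.coe_add]
      rw [add_add_add_comm]
      exact add_le_add (hge₁ x) (hge₂ x)
    · refine (X.eNorm_add_le he₁.aemeasurable he₂.aemeasurable).trans_lt (lt_of_le_of_lt ?_ hδε)
      rw [mul_comm (δ : ℝ≥0∞), mul_assoc, two_mul]
      gcongr

/-- A Borel function is a series of simple functions; their lower semicontinuous majorants are
chosen with summable excess. -/
theorem BoundedSetsAbsCont.hasLscMajorants [μ.OuterRegular]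
    (hfin : ∀ (x : P) (r : ℝ), 0 < r → μ (Metric.ball x r) < ∞) (h : X.BoundedSetsAbsCont) :
    X.HasLscMajorants := by
  intro ρ hρ ε hε
  obtain ⟨δ, hδ, hsum⟩ := exists_pos_tsum_mul_pow_lt X.c X.one_le_c hε
  choose σ e hσ he hle hge hn using fun n => h.exists_lsc_simpleFunc hfin
    (SimpleFunc.eapproxDiff ρ n) (δ n) (hδ n)
  have hρsum := SimpleFunc.tsum_eapproxDiff ρ hρ
  have hem : Measurable fun x => ∑' n, e n x := Measurable.tsum he
  have hlsc : LowerSemicontinuous fun x => ∑' n, σ n x := lowerSemicontinuous_tsum hσ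
  refine ⟨fun x => ∑' n, σ n x, hlsc, fun x => ?_, ?_⟩
  · rw [← hρsum]
    exact ENNReal.tsum_le_tsum fun n => hle n x
  · calc X.eNorm (fun x => ∑' n, σ n x) ≤ X.eNorm (fun x => ρ x + ∑' n, e n x) := by
          refine X.eNorm_mono hlsc.measurable.aemeasurable (hρ.add hem).aemeasurable fun x => ?_
          rw [← hρsum, ← ENNReal.tsum_add]
          exact ENNReal.tsum_le_tsum fun n => hge n x
      _ ≤ X.c * (X.eNorm ρ + X.eNorm (fun x => ∑' n, e n x)) :=
          X.eNorm_add_le hρ.aemeasurable hem.aemeasurable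
      _ ≤ X.c * (X.eNorm ρ + ε) := by
          gcongr
          refine (X.eNorm_tsum_le fun n => (he n).aemeasurable).trans (le_trans ?_ hsum.le)
          refine ENNReal.tsum_le_tsum fun n => ?_
          gcongr
          exact (hn n).le

end QuasiBanachFunctionLattice

/-! ### The Newtonian quasi-norm and capacity -/

theorem le_abs_of_coe_le {a : ℝ≥0∞} {b : EReal} (h : (a : EReal) ≤ b) : a ≤ b.abs := by
  induction b with
  | bot => simp
  | top => simp
  | coe b =>
    rw [← EReal.coe_ennreal_le_coe_ennreal_iff, EReal.coe_abs]
    exact h.trans (EReal.coe_le_coe_iff.2 (le_abs_self b))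

namespace QuasiBanachFunctionLattice

variable {P : Type*} [MetricSpace P] [MeasurableSpace P] {μ : Measure P}
  {X : QuasiBanachFunctionLattice μ}

theorem exists_isUpperGradient_of_newtonNorm_lt {u : P → EReal} {ε : ℝ≥0∞}
    (h : X.newtonNorm u < ε) : ∃ g, IsUpperGradient g u ∧ X.qnorm u + X.eNorm g < ε := by
  rw [newtonNorm] at h
  have h' := lt_tsub_iff_left.2 h
  simp only [iInf_lt_iff] at h'
  obtain ⟨g, hg, hlt⟩ := h'
  refine ⟨g, hg, ?_⟩
  rw [add_comm]
  exact lt_tsub_iff_right.1 hlt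

theorem MemNewton.exists_isUpperGradient {u : P → EReal} (hu : X.MemNewton u) :
    ∃ g, IsUpperGradient g u ∧ X.eNorm g < ∞ := by
  obtain ⟨g, hg, hlt⟩ := exists_isUpperGradient_of_newtonNorm_lt hu.2
  exact ⟨g, hg, lt_of_le_of_lt le_add_self hlt⟩

theorem MemNewton.aeCurve_isAbsContAlong {u : P → EReal} (hu : X.MemNewton u) :
    X.AECurve fun γ => γ.IsAbsContAlong u := by
  obtain ⟨g, hg, hfin⟩ := hu.exists_isUpperGradient
  exact X.aeCurve_of_lineIntegral_eq_top hg.1 hfin fun γ hγ => hg.isAbsContAlong hγ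

theorem newtonNorm_le {u : P → EReal} {g : P → ℝ≥0∞} (hg : IsUpperGradient g u) :
    X.newtonNorm u ≤ X.qnorm u + X.eNorm g :=
  add_le_add le_rfl (iInf_le_of_le g (iInf_le_of_le hg le_rfl))

/-- The capacity may be tested with gradient bounds: truncate the test function at `1`. -/
theorem capacity_le_of_isGradientBound {g w : P → ℝ≥0∞} (h : IsGradientBound g w)
    (hw : AEMeasurable w μ) {E : Set P} (hE : ∀ x ∈ E, 1 ≤ w x) :
    X.capacity E ≤ X.eNorm w + X.eNorm g := by
  have hmin : AEMeasurable (fun x => min 1 (w x)) μ := aemeasurable_const.min hw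
  refine iInf_le_of_le (fun x => ((min 1 (w x) : ℝ≥0∞) : EReal)) <|
    iInf_le_of_le hmin.coe_ereal_ennreal <| iInf_le_of_le (fun x hx => ?_) ?_
  · simp only [min_eq_left (hE x hx)]
    exact le_rfl
  · refine (newtonNorm_le (h.min_one.isUpperGradient fun x => ?_)).trans ?_
    · exact ((min_le_left _ _).trans_lt ENNReal.one_lt_top).ne
    · gcongr
      exact X.eNorm_mono hmin hw fun x => min_le_right _ _

theorem exists_newtonNorm_lt_of_capacity_lt {E : Set P} {ε : ℝ≥0∞} (h : X.capacity E < ε) :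
    ∃ u : P → EReal, AEMeasurable u μ ∧ (∀ x ∈ E, 1 ≤ u x) ∧ X.newtonNorm u < ε := by
  simp only [capacity, iInf_lt_iff] at h
  obtain ⟨u, h1, h2, h3⟩ := h
  exact ⟨u, h1, h2, h3⟩

theorem exists_isGradientBound_of_newtonNorm_lt {u : P → EReal} (hu : AEMeasurable u μ)
    {ε : ℝ≥0∞} (h : X.newtonNorm u < ε) :
    ∃ g, IsGradientBound g (fun x => (u x).abs) ∧
      X.eNorm (fun x => (u x).abs) + X.eNorm g < ε := by
  obtain ⟨g, hg, hlt⟩ := exists_isUpperGradient_of_newtonNorm_lt h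
  exact ⟨g, hg.isGradientBound, by rwa [X.eNorm_abs hu]⟩

theorem exists_isGradientBound_of_capacity_lt {E : Set P} {ε : ℝ≥0∞} (h : X.capacity E < ε) :
    ∃ g w : P → ℝ≥0∞, IsGradientBound g w ∧ AEMeasurable w μ ∧ (∀ x ∈ E, 1 ≤ w x) ∧
      X.eNorm w + X.eNorm g < ε := by
  obtain ⟨u, hu, hE, hlt⟩ := exists_newtonNorm_lt_of_capacity_lt h
  obtain ⟨g, hg, hlt'⟩ := exists_isGradientBound_of_newtonNorm_lt hu hlt
  exact ⟨g, _, hg, aemeasurable_eReal_abs hu,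
    fun x hx => le_abs_of_coe_le (a := 1) (hE x hx), hlt'⟩

theorem capacity_mono {E F : Set P} (h : E ⊆ F) : X.capacity E ≤ X.capacity F :=
  le_iInf fun u => le_iInf fun hu => le_iInf fun hF =>
    iInf_le_of_le u <| iInf_le_of_le hu <| iInf_le_of_le (fun x hx => hF x (h hx)) le_rfl

/-- A function that has finite norm together with one of its gradient bounds is infinite only on a
set of capacity zero: its small multiples are still at least `1` there. -/
theorem capacity_setOf_eq_top {g w : P → ℝ≥0∞} (hb : IsGradientBound g w) (hw : AEMeasurable w μ)
    (hfin : X.eNorm w + X.eNorm g < ∞) : X.capacity {x | w x = ∞} = 0 := by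
  refine le_antisymm (le_of_forall_gt fun ε hε => ?_) bot_le
  obtain ⟨a, ha, hlt⟩ := ENNReal.exists_nnreal_pos_mul_lt hfin.ne hε.ne'
  refine (capacity_le_of_isGradientBound (hb.const_mul a) (hw.const_mul _) fun x hx => ?_).trans_lt
    (lt_of_le_of_lt (le_of_eq ?_) hlt)
  · rw [show w x = ∞ from hx, ENNReal.mul_top (by simpa using ha.ne')]
    exact le_top
  · rw [X.eNorm_const_mul a hw, X.eNorm_const_mul a hb.measurable.aemeasurable, mul_add]

variable [BorelSpace P]

theorem capacity_iUnion_le {E : ℕ → Set P} {δ : ℕ → ℝ≥0∞} (h : ∀ n, X.capacity (E n) < δ n) :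
    X.capacity (⋃ n, E n) ≤ ∑' n, (X.c : ℝ≥0∞) ^ (n + 1) * δ n := by
  choose g w hb hw hE hlt using fun n => exists_isGradientBound_of_capacity_lt (h n)
  refine (capacity_le_of_isGradientBound (IsGradientBound.tsum hb)
    (AEMeasurable.tsum hw) fun x hx => ?_).trans ?_
  · obtain ⟨n, hn⟩ := mem_iUnion.1 hx
    exact (hE n x hn).trans (ENNReal.le_tsum (f := fun n => w n x) n)
  · calc X.eNorm (fun x => ∑' n, w n x) + X.eNorm (fun x => ∑' n, g n x)
        ≤ (∑' n, (X.c : ℝ≥0∞) ^ (n + 1) * X.eNorm (w n))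
          + ∑' n, (X.c : ℝ≥0∞) ^ (n + 1) * X.eNorm (g n) :=
          add_le_add (X.eNorm_tsum_le hw)
            (X.eNorm_tsum_le fun n => (hb n).measurable.aemeasurable)
      _ = ∑' n, (X.c : ℝ≥0∞) ^ (n + 1) * (X.eNorm (w n) + X.eNorm (g n)) := by
          rw [← ENNReal.tsum_add]
          simp only [mul_add]
      _ ≤ _ := ENNReal.tsum_le_tsum fun n => by
          gcongr
          exact (hlt n).le

theorem capacity_union_le {E F : Set P} {a b : ℝ≥0∞} (hE : X.capacity E < a)
    (hF : X.capacity F < b) : X.capacity (E ∪ F) ≤ X.c * (a + b) := by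
  obtain ⟨g, w, hb, hw, hwE, hlt⟩ := exists_isGradientBound_of_capacity_lt hE
  obtain ⟨g', w', hb', hw', hwF, hlt'⟩ := exists_isGradientBound_of_capacity_lt hF
  refine (capacity_le_of_isGradientBound (hb.add hb') (hw.add hw') ?_).trans ?_
  · rintro x (hx | hx)
    · exact (hwE x hx).trans le_self_add
    · exact (hwF x hx).trans le_add_self
  · calc X.eNorm (fun x => w x + w' x) + X.eNorm (fun x => g x + g' x)
        ≤ X.c * (X.eNorm w + X.eNorm w') + X.c * (X.eNorm g + X.eNorm g') :=
          add_le_add (X.eNorm_add_le hw hw')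
            (X.eNorm_add_le hb.measurable.aemeasurable hb'.measurable.aemeasurable)
      _ = X.c * ((X.eNorm w + X.eNorm g) + (X.eNorm w' + X.eNorm g')) := by ring
      _ ≤ _ := by gcongr

/-- A union of two sets of small capacity has small capacity. -/
theorem exists_pos_capacity_union_lt (X : QuasiBanachFunctionLattice μ) {ε : ℝ≥0∞}
    (hε : 0 < ε) : ∃ δ : ℝ≥0∞, 0 < δ ∧ ∀ E F : Set P, X.capacity E < δ → X.capacity F < δ →
      X.capacity (E ∪ F) < ε := by
  obtain ⟨δ, hδ, hδε⟩ := ENNReal.exists_nnreal_pos_mul_lt (a := (X.c : ℝ≥0∞) * 2)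
    (by finiteness) hε.ne'
  refine ⟨δ, by exact_mod_cast hδ, fun E F hE hF =>
    (capacity_union_le hE hF).trans_lt (lt_of_le_of_lt (le_of_eq ?_) hδε)⟩
  ring

/-- If functions `w n` and their gradient bounds `g n` tend to zero fast in quasi-norm, then almost
every curve has an index `n` for which `w n` stays below `1` on the whole curve. On the remaining
curves, `w n` reaches the value `1` and hence stays above `1 / 2` for all large `n`. -/
theorem exists_density_of_tsum_lt_top {g w : ℕ → P → ℝ≥0∞} (hb : ∀ n, IsGradientBound (g n) (w n))
    (hw : ∀ n, AEMeasurable (w n) μ)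
    (hsum : ∑' n, (X.c : ℝ≥0∞) ^ (n + 1) * (X.eNorm (w n) + X.eNorm (g n)) < ∞) :
    ∃ ρ : P → ℝ≥0∞, Measurable ρ ∧ X.eNorm ρ < ∞ ∧ ∀ γ : Curve P, γ.lineIntegral ρ < ∞ →
      ∃ n, ∀ t ∈ Icc 0 γ.len, w n (γ.toFun t) < 1 := by
  choose w' hw'm hw'ge hw'ae using fun n => exists_measurable_ge_ae_eq (hw n)
  have hm : ∀ n, Measurable fun x => w' n x + g n x := fun n => (hw'm n).add (hb n).measurable
  refine ⟨fun x => ∑' n, (w' n x + g n x), Measurable.tsum hm, ?_, fun γ hγ => ?_⟩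
  · refine (X.eNorm_tsum_le fun n => (hm n).aemeasurable).trans_lt ?_
    refine lt_of_le_of_lt (ENNReal.tsum_le_tsum
      (g := fun n => X.c * ((X.c : ℝ≥0∞) ^ (n + 1) * (X.eNorm (w n) + X.eNorm (g n))))
      fun n => ?_) ?_
    · rw [mul_left_comm, ← X.eNorm_congr_ae (hw n) (hw'ae n)]
      gcongr
      exact X.eNorm_add_le (hw'm n).aemeasurable (hb n).measurable.aemeasurable
    · rw [ENNReal.tsum_mul_left]
      exact ENNReal.mul_lt_top ENNReal.coe_lt_top hsum
  · rw [γ.lineIntegral_tsum hm] at hγ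
    have hL : 0 < ENNReal.ofReal γ.len := ENNReal.ofReal_pos.2 γ.len_pos
    have hhalf : (0 : ℝ≥0∞) < min 2⁻¹ (ENNReal.ofReal γ.len * 2⁻¹) :=
      lt_min (by simp) (ENNReal.mul_pos hL.ne' (by simp))
    obtain ⟨n, hn⟩ := ((ENNReal.tendsto_atTop_zero_of_tsum_ne_top hγ.ne).eventually
      (gt_mem_nhds hhalf)).exists
    rw [γ.lineIntegral_add (hw'm n), lt_min_iff] at hn
    refine ⟨n, fun t ht => ?_⟩
    by_contra! h1
    have hge : ∀ r ∈ Icc 0 γ.len, 2⁻¹ ≤ w' n (γ.toFun r) := by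
      intro r hr
      have h2 := h1.trans ((hb n).le_add_lineIntegral γ ht hr)
      have h3 : γ.lineIntegral (g n) ≤ 2⁻¹ := (le_add_self.trans_lt hn.1).le
      have h4 : (1 : ℝ≥0∞) ≤ w n (γ.toFun r) + 2⁻¹ := h2.trans (by gcongr)
      rw [← tsub_le_iff_right, ENNReal.one_sub_inv_two] at h4
      exact h4.trans (hw'ge n _)
    have hint : ENNReal.ofReal γ.len * 2⁻¹ ≤ γ.lineIntegral (w' n) := by
      calc ENNReal.ofReal γ.len * 2⁻¹ = ∫⁻ _ in Icc 0 γ.len, (2⁻¹ : ℝ≥0∞) := by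
            simp [mul_comm]
        _ ≤ _ := setLIntegral_mono' measurableSet_Icc hge
    exact absurd (hint.trans_lt (le_self_add.trans_lt hn.2)) (lt_irrefl _)

/-- Almost every curve avoids a set of capacity zero. -/
theorem exists_density_of_capacity_eq_zero {Z : Set P} (hZ : X.capacity Z = 0) :
    ∃ ρ : P → ℝ≥0∞, Measurable ρ ∧ X.eNorm ρ < ∞ ∧ ∀ γ : Curve P, γ.lineIntegral ρ < ∞ →
      ∀ t ∈ Icc 0 γ.len, γ.toFun t ∉ Z := by
  obtain ⟨δ, hδ, hsum⟩ := exists_pos_tsum_mul_pow_lt X.c X.one_le_c (ε := 1) one_pos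
  choose g w hb hw hE hlt using fun n =>
    exists_isGradientBound_of_capacity_lt (X := X) (E := Z) (hZ ▸ hδ n)
  obtain ⟨ρ, hρ, hfin, hav⟩ := exists_density_of_tsum_lt_top hb hw (lt_of_le_of_lt
    (ENNReal.tsum_le_tsum fun n => by
      gcongr
      exact (hlt n).le) (hsum.trans ENNReal.one_lt_top))
  refine ⟨ρ, hρ, hfin, fun γ hγ t ht hmem => ?_⟩
  obtain ⟨n, hn⟩ := hav γ hγ
  exact absurd (hE n _ hmem) (not_le.2 (hn t ht))

/-! ### Open neighbourhoods of sets of capacity zero -/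

/-- If every curve that meets `Z` has `ρ`-length at least `1`, then the truncated cost of escaping
from `V`, with respect to the density `ρ + 1`, is an admissible function for the capacity of an open
neighbourhood of `Z`. -/
theorem exists_isOpen_capacity_le {V Z : Set P} (hV : IsOpen V) (hK : IsCompact (closure V))
    (hZV : Z ⊆ V) {ρ : P → ℝ≥0∞} (hρ : LowerSemicontinuous ρ)
    (hcurve : ∀ z ∈ Z, ∀ c : Curve P, c.toFun 0 = z → 1 ≤ c.lineIntegral ρ) :
    ∃ U, IsOpen U ∧ Z ⊆ U ∧ X.capacity U ≤
      2 * (X.eNorm (V.indicator 1) + X.c * (X.eNorm (V.indicator 1) + X.eNorm ρ)) := by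
  have h1V : LowerSemicontinuous (V.indicator (1 : P → ℝ≥0∞)) :=
    hV.lowerSemicontinuous_indicator zero_le_one
  set g : P → ℝ≥0∞ := V.indicator fun x => 1 + ρ x with hg
  have hglsc : LowerSemicontinuous g := by
    intro x a ha
    by_cases hx : x ∈ V
    · have hlsc : LowerSemicontinuous fun x => 1 + ρ x := lowerSemicontinuous_const.add hρ
      rw [hg, indicator_of_mem hx] at ha
      filter_upwards [hlsc x a ha, hV.mem_nhds hx] with y hy hyV
      rwa [hg, indicator_of_mem hyV]
    · rw [hg, indicator_of_notMem hx] at ha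
      exact absurd ha not_lt_bot
  have hg1 : ∀ x ∈ V, 1 ≤ g x := fun x hx => by
    rw [hg, indicator_of_mem hx]
    exact le_self_add
  have hgρ : ∀ x ∈ V, ρ x ≤ g x := fun x hx => by
    rw [hg, indicator_of_mem hx]
    exact le_add_self
  have hg0 : ∀ x ∉ V, g x = 0 := fun x hx => by rw [hg, indicator_of_notMem hx]
  set w : P → ℝ≥0∞ := fun x => min 1 (escapeCost g x) with hw
  have hwlsc : LowerSemicontinuous w := lowerSemicontinuous_min_escapeCost hV hK hglsc hg0 hg1
  have hb : IsGradientBound g w := (isGradientBound_escapeCost hglsc.measurable).min_one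
  refine ⟨{x | 2⁻¹ < w x}, hwlsc.isOpen_preimage _, fun z hz => ?_, ?_⟩
  · have : w z = 1 := min_eq_left (one_le_escapeCost hV hg1 hgρ (hZV hz) (hcurve z hz))
    simp [this]
  · refine (capacity_le_of_isGradientBound (hb.const_mul 2)
      (hwlsc.measurable.const_mul _).aemeasurable fun x hx => ?_).trans ?_
    · have hx' : (2 : ℝ≥0∞)⁻¹ ≤ w x := le_of_lt hx
      calc (1 : ℝ≥0∞) = 2 * 2⁻¹ := (ENNReal.mul_inv_cancel (by simp) (by simp)).symm
        _ ≤ 2 * w x := by gcongr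
        _ = _ := rfl
    · rw [X.eNorm_const_mul 2 hwlsc.measurable.aemeasurable,
        X.eNorm_const_mul 2 hglsc.measurable.aemeasurable, ← mul_add]
      gcongr ?_ * (?_ + ?_)
      · exact le_rfl
      · refine X.eNorm_mono hwlsc.measurable.aemeasurable h1V.measurable.aemeasurable fun x => ?_
        by_cases hx : x ∈ V
        · rw [indicator_of_mem hx]
          exact min_le_left _ _
        · simp [hw, escapeCost_eq_zero (hg0 x hx)]
      · refine (X.eNorm_mono hglsc.measurable.aemeasurable
          (h1V.measurable.add hρ.measurable).aemeasurable fun x => ?_).trans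
          (X.eNorm_add_le h1V.measurable.aemeasurable hρ.measurable.aemeasurable)
        by_cases hx : x ∈ V <;> simp [hg, hx]

/-- Open neighbourhoods of small capacity for a set of capacity zero in a relatively compact open
set. -/
theorem HasLscMajorants.exists_isOpen_capacity_lt_of_subset (hX : X.HasLscMajorants)
    {B Z : Set P} (hB : IsOpen B) (hK : IsCompact (closure B)) (hZB : Z ⊆ B)
    (hZ : X.capacity Z = 0) {ε : ℝ≥0∞} (hε : 0 < ε) :
    ∃ U, IsOpen U ∧ Z ⊆ U ∧ X.capacity U < ε := by
  obtain ⟨δ, hδ, hδε⟩ := ENNReal.exists_nnreal_pos_mul_lt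
    (a := 2 * (3 * X.c + X.c * (3 * X.c + 2 * X.c) : ℝ≥0∞)) (by finiteness) hε.ne'
  have hδ' : (0 : ℝ≥0∞) < δ := by exact_mod_cast hδ
  -- a lower semicontinuous density of small quasi-norm detecting the curves that meet `Z`
  obtain ⟨ρ₀, hρ₀, hfin, hav⟩ := exists_density_of_capacity_eq_zero hZ
  obtain ⟨a, ha, hlt⟩ := X.exists_pos_eNorm_const_mul_lt hρ₀.aemeasurable hfin hδ'
  obtain ⟨ρ, hρ, hρge, hρn⟩ := hX _ (hρ₀.const_mul (a : ℝ≥0∞)) δ hδ'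
  have hρn' : X.eNorm ρ ≤ (2 * X.c : ℝ≥0∞) * δ := by
    refine hρn.trans ((mul_le_mul_right (add_le_add hlt.le le_rfl) _).trans_eq ?_)
    ring
  have hcurve : ∀ z ∈ Z, ∀ c : Curve P, c.toFun 0 = z → 1 ≤ c.lineIntegral ρ := by
    intro z hz c hcz
    have htop : c.lineIntegral ρ₀ = ∞ := by
      by_contra hne
      exact hav c (lt_top_iff_ne_top.2 hne) 0 (left_mem_Icc.2 c.len_pos.le) (hcz ▸ hz)
    refine le_trans ?_ (c.lineIntegral_mono hρge)
    rw [c.lineIntegral_const_mul, htop, ENNReal.mul_top (by simpa using ha.ne')]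
    exact le_top
  -- an open neighbourhood of `Z` whose characteristic function has small quasi-norm
  obtain ⟨g₀, w, -, hw, hwZ, hwδ⟩ :=
    exists_isGradientBound_of_capacity_lt (X := X) (E := Z) (hZ ▸ hδ')
  obtain ⟨w', hw'm, hw'ge, hw'ae⟩ := exists_measurable_ge_ae_eq hw
  obtain ⟨σ, hσ, hσge, hσn⟩ := hX _ (hw'm.const_mul ((2 : ℝ≥0) : ℝ≥0∞)) δ hδ'
  set V := B ∩ {x | 1 < σ x} with hVdef
  have hV : IsOpen V := hB.inter (hσ.isOpen_preimage 1)
  have hZV : Z ⊆ V := fun z hz => by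
    refine ⟨hZB hz, lt_of_lt_of_le ?_ (hσge z)⟩
    have h1 : 1 ≤ w' z := (hwZ z hz).trans (hw'ge z)
    calc (1 : ℝ≥0∞) < ((2 : ℝ≥0) : ℝ≥0∞) * 1 := by simp
      _ ≤ _ := by gcongr
  have hVn : X.eNorm (V.indicator 1) ≤ (3 * X.c : ℝ≥0∞) * δ := by
    have h1 : X.eNorm (V.indicator 1) ≤ X.eNorm σ := by
      refine X.eNorm_mono (measurable_one.indicator hV.measurableSet).aemeasurable
        hσ.measurable.aemeasurable fun x => ?_
      by_cases hx : x ∈ V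
      · rw [indicator_of_mem hx]
        exact le_of_lt hx.2
      · simp [hx]
    refine h1.trans (hσn.trans ?_)
    rw [X.eNorm_const_mul 2 hw'm.aemeasurable, X.eNorm_congr_ae hw hw'ae]
    have h2 : X.eNorm w ≤ δ := (le_self_add.trans_lt hwδ).le
    calc (X.c : ℝ≥0∞) * (((2 : ℝ≥0) : ℝ≥0∞) * X.eNorm w + δ)
        ≤ X.c * (((2 : ℝ≥0) : ℝ≥0∞) * δ + δ) := by gcongr
      _ = _ := by
        rw [ENNReal.coe_ofNat]
        ring
  have hKV : IsCompact (closure V) := hK.of_isClosed_subset isClosed_closure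
    (closure_mono inter_subset_left)
  obtain ⟨U, hU, hZU, hUcap⟩ := exists_isOpen_capacity_le (X := X) hV hKV hZV hρ hcurve
  refine ⟨U, hU, hZU, hUcap.trans_lt (lt_of_le_of_lt ?_ hδε)⟩
  calc 2 * (X.eNorm (V.indicator 1) + X.c * (X.eNorm (V.indicator 1) + X.eNorm ρ))
      ≤ 2 * ((3 * X.c : ℝ≥0∞) * δ + X.c * ((3 * X.c : ℝ≥0∞) * δ + (2 * X.c : ℝ≥0∞) * δ)) := by
        gcongr
    _ = _ := by ring

/-- A set of capacity zero has open neighbourhoods of arbitrarily small capacity. -/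
theorem HasLscMajorants.exists_isOpen_capacity_lt [LocallyCompactSpace P]
    [SecondCountableTopology P] (hX : X.HasLscMajorants) {Z : Set P} (hZ : X.capacity Z = 0)
    {ε : ℝ≥0∞} (hε : 0 < ε) : ∃ U, IsOpen U ∧ Z ⊆ U ∧ X.capacity U < ε := by
  obtain ⟨δ, hδ, hsum⟩ := exists_pos_tsum_mul_pow_lt X.c X.one_le_c hε
  let K := CompactExhaustion.choice P
  have hzero : ∀ n, X.capacity (Z ∩ interior (K n)) = 0 := fun n =>
    le_antisymm ((capacity_mono inter_subset_left).trans_eq hZ) bot_le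
  choose U hU hZU hUδ using fun n => hX.exists_isOpen_capacity_lt_of_subset isOpen_interior
    ((K.isCompact n).of_isClosed_subset isClosed_closure
      (closure_minimal interior_subset (K.isCompact n).isClosed))
    inter_subset_right (hzero n) (hδ n)
  refine ⟨⋃ n, U n, isOpen_iUnion hU, fun z hz => ?_, (capacity_iUnion_le hUδ).trans_lt hsum⟩
  obtain ⟨n, hn⟩ := K.exists_mem z
  exact mem_iUnion.2 ⟨n + 1, hZU (n + 1) ⟨hz, K.subset_interior_succ n hn⟩⟩

/-! ### Absolute continuity along almost every curve -/

/-- A function that is absolutely continuous along almost every curve agrees along almost every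
curve with any Newtonian representative, hence shares its upper gradients up to a correction on an
exceptional family of curves. -/
theorem AECurve.memNewton {u v : P → EReal} (hv : X.MemNewton v) (huv : u =ᵐ[μ] v)
    (h : X.AECurve fun γ => γ.IsAbsContAlong u) : X.MemNewton u := by
  obtain ⟨g, hg, hgfin⟩ := hv.exists_isUpperGradient
  obtain ⟨ρ, hρ, hρfin, hρac⟩ := h.exists_lineIntegral_eq_top
  obtain ⟨N, hN, hNm, hN0⟩ := exists_measurable_superset_of_null (ae_iff.1 huv)
  have hNρ : Measurable (N.indicator fun _ => (∞ : ℝ≥0∞)) := measurable_const.indicator hNm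
  have hug : IsUpperGradient (fun x => g x + (ρ x + N.indicator (fun _ => ∞) x)) u := by
    refine ⟨hg.1.add (hρ.add hNρ), fun γ => ?_⟩
    rw [γ.lineIntegral_add hg.1, γ.lineIntegral_add hρ]
    by_cases hfin : γ.lineIntegral g + (γ.lineIntegral ρ +
        γ.lineIntegral (N.indicator fun _ => ∞)) = ∞
    · rw [hfin]
      exact le_top
    simp only [ENNReal.add_eq_top, not_or, ← lt_top_iff_ne_top] at hfin
    have heq := (hρac γ hfin.2.1).eq_of_ae_eq (hg.isAbsContAlong hfin.1) (by
      filter_upwards [γ.ae_notMem_of_lineIntegral_lt_top hNm hfin.2.2] with t ht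
      by_contra hne
      exact ht (hN hne))
    rw [heq 0 (left_mem_Icc.2 γ.len_pos.le), heq γ.len (right_mem_Icc.2 γ.len_pos.le)]
    exact (hg.2 γ).trans le_self_add
  refine ⟨hv.1.congr huv.symm, (newtonNorm_le hug).trans_lt ?_⟩
  rw [X.qnorm_congr_ae hv.1 huv]
  refine ENNReal.add_lt_top.2 ⟨le_self_add.trans_lt hv.2, ?_⟩
  refine X.eNorm_add_lt_top hg.1.aemeasurable (hρ.add hNρ).aemeasurable hgfin ?_
  refine X.eNorm_add_lt_top hρ.aemeasurable hNρ.aemeasurable hρfin ?_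
  rw [X.eNorm_indicator_null hN0]
  exact ENNReal.zero_lt_top

/-! ### Quasi-continuity of Newtonian functions -/

theorem aemeasurable_sub_coe {u : P → EReal} (hu : AEMeasurable u μ) {f : P → ℝ}
    (hf : Continuous f) : AEMeasurable (fun x => u x - (f x : EReal)) μ := by
  simp only [sub_eq_add_neg]
  exact hu.add hf.measurable.coe_real_ereal.neg.aemeasurable

/-- A finite bound on `k * |a - b|` with `b` real forces `a` to be real. -/
theorem exists_real_of_mul_abs_sub_le {a : EReal} {b : ℝ} {k : ℝ≥0} (hk : 0 < k) {W : ℝ≥0}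
    (h : (k : ℝ≥0∞) * (a - b).abs ≤ W) : ∃ r : ℝ, a = r ∧ k * |r - b| ≤ W := by
  have hk' : (k : ℝ≥0∞) ≠ 0 := by exact_mod_cast hk.ne'
  induction a with
  | bot =>
    rw [EReal.bot_sub, EReal.abs_bot, ENNReal.mul_top hk'] at h
    exact absurd h (not_le.2 ENNReal.coe_lt_top)
  | top =>
    rw [EReal.top_sub_coe, EReal.abs_top, ENNReal.mul_top hk'] at h
    exact absurd h (not_le.2 ENNReal.coe_lt_top)
  | coe r =>
    refine ⟨r, rfl, ?_⟩
    rw [← EReal.coe_sub, EReal.abs_def] at h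
    have := ENNReal.toReal_mono ENNReal.coe_ne_top h
    simpa [ENNReal.toReal_mul, abs_nonneg] using this

/-- If continuous functions are dense, then a Newtonian function is the limit of continuous
functions, uniformly outside an open set of small capacity. The weighted sum `w` of the errors
controls both the open set where consecutive approximations differ too much and the set of capacity
zero where the approximations need not converge to the given function. -/
theorem MemNewton.quasiContinuous [LocallyCompactSpace P] [SecondCountableTopology P]
    (hdense : X.ContinuousDense) (hX : X.HasLscMajorants) {u : P → EReal} (hu : X.MemNewton u) :
    X.QuasiContinuous u := by
  intro ε hε
  obtain ⟨δ, hδ, hunion⟩ := X.exists_pos_capacity_union_lt hε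
  obtain ⟨η, hη, hsum⟩ := exists_pos_tsum_mul_pow_lt X.c X.one_le_c hδ
  let k : ℕ → ℝ≥0 := fun n => 2 ^ n
  have hk : ∀ n, 0 < k n := fun n => by positivity
  have hη' : ∀ n, 0 < η n / (k n : ℝ≥0∞) := fun n =>
    ENNReal.div_pos (hη n).ne' ENNReal.coe_ne_top
  choose f hf _ hfη using fun n => hdense u hu _ (hη' n)
  have hm := fun n => aemeasurable_sub_coe hu.1 (hf n)
  have hDm := fun n => aemeasurable_eReal_abs (hm n)
  choose g hb hlt using fun n => exists_isGradientBound_of_newtonNorm_lt (hm n) (hfη n)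
  have hkm : ∀ n, AEMeasurable (fun x => (k n : ℝ≥0∞) * (u x - (f n x : EReal)).abs) μ :=
    fun n => (hDm n).const_mul _
  set w : P → ℝ≥0∞ := fun x => ∑' n, (k n : ℝ≥0∞) * (u x - (f n x : EReal)).abs
  have hwm : AEMeasurable w μ := AEMeasurable.tsum hkm
  set h : P → ℝ≥0∞ := fun x => ∑' n, (k n : ℝ≥0∞) * g n x
  have hwb : IsGradientBound h w := IsGradientBound.tsum fun n => (hb n).const_mul (k n)
  have hnorm : X.eNorm w + X.eNorm h < δ := by
    refine lt_of_le_of_lt (add_le_add (X.eNorm_tsum_le hkm) (X.eNorm_tsum_le fun n =>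
      ((hb n).measurable.const_mul _).aemeasurable)) (lt_of_le_of_lt ?_ hsum)
    rw [← ENNReal.tsum_add]
    refine ENNReal.tsum_le_tsum fun n => ?_
    rw [X.eNorm_const_mul _ (hDm n), X.eNorm_const_mul _ (hb n).measurable.aemeasurable,
      ← mul_add, ← mul_add]
    gcongr
    rw [mul_comm]
    exact ENNReal.mul_le_of_le_div (hlt n).le
  have hreal : ∀ x, ∀ W : ℝ≥0, w x ≤ W → ∀ n, ∃ r : ℝ, u x = r ∧ k n * |r - f n x| ≤ W :=
    fun x W hW n => exists_real_of_mul_abs_sub_le (hk n)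
      ((ENNReal.le_tsum (f := fun n => (k n : ℝ≥0∞) * (u x - (f n x : EReal)).abs) n).trans hW)
  have hkreal : ∀ n, ((k n : ℝ≥0) : ℝ) = 2 ^ n := fun n => by simp [k]
  -- the open set where consecutive approximations are far apart
  set G : Set P := ⋃ n, {x | 4 / 2 / 2 ^ n < dist (f n x) (f (n + 1) x)}
  have hGo : IsOpen G := isOpen_iUnion fun n =>
    isOpen_lt continuous_const ((hf n).dist (hf (n + 1)))
  have hGw : ∀ x ∈ G, 1 ≤ w x := by
    intro x hx
    by_contra! hlt1
    obtain ⟨n, hn⟩ := mem_iUnion.1 hx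
    obtain ⟨r, hr, hrn⟩ := hreal x 1 hlt1.le n
    obtain ⟨r', hr', hrn'⟩ := hreal x 1 hlt1.le (n + 1)
    obtain rfl : r = r' := by exact_mod_cast hr.symm.trans hr'
    rw [hkreal, NNReal.coe_one, ← le_div_iff₀' (by positivity)] at hrn hrn'
    have h2 : (1 : ℝ) / 2 ^ (n + 1) ≤ 1 / 2 ^ n :=
      one_div_le_one_div_of_le (by positivity) (pow_le_pow_right₀ one_le_two n.le_succ)
    have h3 : (4 : ℝ) / 2 / 2 ^ n = 1 / 2 ^ n + 1 / 2 ^ n := by ring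
    have h4 : 4 / 2 / 2 ^ n < dist (f n x) (f (n + 1) x) := hn
    have h5 := dist_triangle_left (f n x) (f (n + 1) x) r
    rw [Real.dist_eq r, Real.dist_eq r] at h5
    linarith
  have hGcap : X.capacity G < δ := (capacity_le_of_isGradientBound hwb hwm hGw).trans_lt hnorm
  obtain ⟨U, hU, hZU, hUcap⟩ := hX.exists_isOpen_capacity_lt
    (capacity_setOf_eq_top hwb hwm (hnorm.trans_le le_top)) hδ
  refine ⟨G ∪ U, hGo.union hU, hunion G U hGcap hUcap, ?_⟩
  have hfinite : ∀ x ∈ (G ∪ U)ᶜ, ∃ r : ℝ, u x = r ∧ ∀ n, dist (f n x) r ≤ 4 / 2 ^ n := by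
    intro x hx
    rw [mem_compl_iff, mem_union, not_or] at hx
    have hwx : w x ≠ ∞ := fun htop => hx.2 (hZU htop)
    lift w x to ℝ≥0 using hwx with W hW
    obtain ⟨r, hr, -⟩ := hreal x W hW.ge 0
    have hbound : ∀ n, dist (f n x) r ≤ W * (1 / 2) ^ n := by
      intro n
      obtain ⟨r', hr', hrn⟩ := hreal x W hW.ge n
      obtain rfl : r = r' := by exact_mod_cast hr.symm.trans hr'
      rw [hkreal, ← le_div_iff₀' (by positivity)] at hrn
      rw [dist_comm, Real.dist_eq]
      refine hrn.trans_eq ?_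
      rw [one_div, inv_pow, div_eq_mul_inv]
    have hlim : Tendsto (fun n => f n x) atTop (𝓝 r) := by
      refine tendsto_iff_dist_tendsto_zero.2 (squeeze_zero (fun _ => dist_nonneg) hbound ?_)
      simpa using (tendsto_pow_atTop_nhds_zero_of_lt_one (r := (1 / 2 : ℝ)) (by norm_num)
        (by norm_num)).const_mul (W : ℝ)
    refine ⟨r, hr, dist_le_of_le_geometric_two_of_tendsto (fun n => ?_) hlim⟩
    by_contra! hfar
    exact hx.1 (mem_iUnion.2 ⟨n, hfar⟩)
  refine ⟨fun x hx => ?_, ?_⟩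
  · obtain ⟨r, hr, -⟩ := hfinite x hx
    rw [hr]
    exact ⟨EReal.coe_ne_top r, EReal.coe_ne_bot r⟩
  · have hunif : TendstoUniformlyOn f (fun x => (u x).toReal) atTop (G ∪ U)ᶜ := by
      rw [Metric.tendstoUniformlyOn_iff]
      intro e he
      have hgeo : Tendsto (fun n : ℕ => (4 : ℝ) / 2 ^ n) atTop (𝓝 0) := by
        simpa [div_eq_mul_inv] using (tendsto_pow_atTop_nhds_zero_of_lt_one (r := (2⁻¹ : ℝ))
          (by norm_num) (by norm_num)).const_mul (4 : ℝ)
      filter_upwards [hgeo.eventually (gt_mem_nhds he)] with n hn x hx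
      obtain ⟨r, hr, hd⟩ := hfinite x hx
      rw [hr, EReal.toReal_coe, dist_comm]
      exact (hd n).trans_lt hn
    have hcont := hunif.continuousOn (Frequently.of_forall fun n => (hf n).continuousOn)
    refine (continuous_coe_real_ereal.comp_continuousOn hcont).congr fun x hx => ?_
    obtain ⟨r, hr, -⟩ := hfinite x hx
    simp [hr]

/-! ### Weak quasi-continuity -/

/-- If Newtonian functions are quasi-continuous, then every set of small capacity is contained in
an open set of small capacity, namely the union of an open set of small capacity and a relatively
open superlevel set of a test function. -/
theorem exists_pos_forall_capacity_lt_exists_isOpen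
    (hq : ∀ u : P → EReal, X.MemNewton u → X.QuasiContinuous u) {ε : ℝ≥0∞} (hε : 0 < ε) :
    ∃ δ : ℝ≥0∞, 0 < δ ∧ ∀ E : Set P, X.capacity E < δ →
      ∃ U, IsOpen U ∧ E ⊆ U ∧ X.capacity U < ε := by
  obtain ⟨δ, hδ, hunion⟩ := X.exists_pos_capacity_union_lt hε
  obtain ⟨η, hη, hηδ⟩ := ENNReal.exists_nnreal_pos_mul_lt (a := 2) (by simp) hδ.ne'
  refine ⟨η, by exact_mod_cast hη, fun E hE => ?_⟩
  obtain ⟨u, hu, hEu, hlt⟩ := exists_newtonNorm_lt_of_capacity_lt hE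
  obtain ⟨G, hG, hGδ, -, hcont⟩ := hq u ⟨hu, hlt.trans_le le_top⟩ δ hδ
  set a : EReal := ((2⁻¹ : ℝ≥0∞) : EReal)
  have hScap : X.capacity {x | a < u x} < δ := by
    obtain ⟨g, hb, hn⟩ := exists_isGradientBound_of_newtonNorm_lt hu hlt
    have hm := aemeasurable_eReal_abs hu
    refine (capacity_le_of_isGradientBound (hb.const_mul 2) (hm.const_mul _)
      fun x hx => ?_).trans_lt (lt_of_le_of_lt ?_ hηδ)
    · have h2 : (2⁻¹ : ℝ≥0∞) ≤ (u x).abs := le_abs_of_coe_le (le_of_lt hx)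
      calc (1 : ℝ≥0∞) = 2 * 2⁻¹ := (ENNReal.mul_inv_cancel (by simp) (by simp)).symm
        _ ≤ 2 * (u x).abs := by gcongr
        _ = _ := rfl
    · rw [X.eNorm_const_mul 2 hm, X.eNorm_const_mul 2 hb.measurable.aemeasurable, ← mul_add,
        mul_comm]
      exact mul_le_mul hn.le le_rfl bot_le bot_le
  refine ⟨G ∪ {x | a < u x}, ?_, fun x hx => Or.inr ?_, hunion _ _ hGδ hScap⟩
  · rw [← isClosed_compl_iff]
    have := hcont.preimage_isClosed_of_isClosed hG.isClosed_compl (isClosed_Iic (a := a))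
    convert this using 1
    ext x
    simp
  · refine lt_of_lt_of_le ?_ (hEu x hx)
    have : (2⁻¹ : ℝ≥0∞) < 1 := ENNReal.one_half_lt_one
    exact EReal.coe_ennreal_lt_coe_ennreal_iff.2 this

theorem WeaklyQuasiContinuous.quasiContinuous
    (hq : ∀ u : P → EReal, X.MemNewton u → X.QuasiContinuous u) {u : P → EReal}
    (h : X.WeaklyQuasiContinuous u) : X.QuasiContinuous u := by
  intro ε hε
  obtain ⟨δ, hδ, hopen⟩ := exists_pos_forall_capacity_lt_exists_isOpen hq hε
  obtain ⟨E, hE, hcont⟩ := h δ hδ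
  obtain ⟨U, hU, hEU, hUε⟩ := hopen E hE
  exact ⟨U, hU, hUε, fun x hx => hcont.1 x fun hxE => hx (hEU hxE),
    hcont.2.mono (compl_subset_compl.2 hEU)⟩

/-! ### Quasi-continuous functions that agree almost everywhere -/

/-- Two quasi-continuous functions that agree almost everywhere agree along almost every curve. If
they are continuous outside the open set `G`, then the set where they differ becomes open after
adding `G`, so a curve that meets it also meets `G`, because it spends no time in the null set. -/
theorem QuasiContinuous.aeCurve_isAbsContAlong {u v : P → EReal} (hu : X.QuasiContinuous u)
    (hv : X.QuasiContinuous v) (huv : u =ᵐ[μ] v) (hac : X.AECurve fun γ => γ.IsAbsContAlong v) :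
    X.AECurve fun γ => γ.IsAbsContAlong u := by
  obtain ⟨δ, hδ, hsum⟩ := exists_pos_tsum_mul_pow_lt X.c X.one_le_c (ε := 1) one_pos
  have hG : ∀ n, ∃ G, IsOpen G ∧ X.capacity G < δ n ∧ ContinuousOn u Gᶜ ∧ ContinuousOn v Gᶜ := by
    intro n
    obtain ⟨η, hη, hunion⟩ := X.exists_pos_capacity_union_lt (hδ n)
    obtain ⟨G, hGo, hGc, hGu⟩ := hu η hη
    obtain ⟨G', hGo', hGc', hGv⟩ := hv η hη
    exact ⟨G ∪ G', hGo.union hGo', hunion G G' hGc hGc',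
      hGu.2.mono (compl_subset_compl.2 subset_union_left),
      hGv.2.mono (compl_subset_compl.2 subset_union_right)⟩
  choose G hGo hGc hGu hGv using hG
  choose g w hb hw hGw hlt using fun n => exists_isGradientBound_of_capacity_lt (hGc n)
  obtain ⟨ρ, hρ, hρfin, hav⟩ := exists_density_of_tsum_lt_top hb hw (lt_of_le_of_lt
    (ENNReal.tsum_le_tsum fun n => by
      gcongr
      exact (hlt n).le) (hsum.trans ENNReal.one_lt_top))
  obtain ⟨σ, hσ, hσfin, hσac⟩ := hac.exists_lineIntegral_eq_top
  obtain ⟨N, hN, hNm, hN0⟩ := exists_measurable_superset_of_null (ae_iff.1 huv)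
  have hNρ : Measurable (N.indicator fun _ => (∞ : ℝ≥0∞)) := measurable_const.indicator hNm
  refine X.aeCurve_of_lineIntegral_eq_top
    (ρ := fun x => ρ x + (σ x + N.indicator (fun _ => ∞) x)) (hρ.add (hσ.add hNρ)) ?_
    fun γ hγ => ?_
  · refine X.eNorm_add_lt_top hρ.aemeasurable (hσ.add hNρ).aemeasurable hρfin ?_
    refine X.eNorm_add_lt_top hσ.aemeasurable hNρ.aemeasurable hσfin ?_
    rw [X.eNorm_indicator_null hN0]
    exact ENNReal.zero_lt_top
  · rw [γ.lineIntegral_add hρ, γ.lineIntegral_add hσ, ENNReal.add_lt_top,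
      ENNReal.add_lt_top] at hγ
    obtain ⟨n, hn⟩ := hav γ hγ.1
    refine (hσac γ hγ.2.1).congr fun t ht => ?_
    by_contra hne
    have hWo : IsOpen (G n ∪ {x | u x ≠ v x}) := by
      rw [← isClosed_compl_iff]
      have := ((hGu n).prodMk (hGv n)).preimage_isClosed_of_isClosed (hGo n).isClosed_compl
        isClosed_diagonal
      convert this using 1
      ext x
      simp
    obtain ⟨s, hs, hsW, hsN⟩ := Curve.exists_mem_of_ae hWo ht (Or.inr hne)
      (γ.ae_notMem_of_lineIntegral_lt_top hNm hγ.2.2)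
    rcases hsW with hsG | hs'
    · exact absurd (hGw n _ hsG) (not_le.2 (hn s hs))
    · exact hsN (hN hs')

end QuasiBanachFunctionLattice

end NewtonianLattice
end

theorem mainTheorem12 {P : Type*} [MetricSpace P] [MeasurableSpace P] [BorelSpace P]
    [LocallyCompactSpace P] (μ : Measure P) [SigmaFinite μ]
    (hball : ∀ (x : P) (r : ℝ), 0 < r → 0 < μ (Metric.ball x r) ∧ μ (Metric.ball x r) < ∞)
    (X : NewtonianLattice.QuasiBanachFunctionLattice μ)
    (hdense : X.ContinuousDense)
    (hVC : X.VitaliCaratheodory ∨ X.BoundedSetsAbsCont)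
    (u v : P → EReal) (hv : X.MemNewton v) (huv : u =ᵐ[μ] v) :
    List.TFAE [
      X.MemNewton u,
      X.AECurve (fun γ => γ.IsAbsContAlong u),
      X.WeaklyQuasiContinuous u,
      X.QuasiContinuous u] := by
  have hsc : SecondCountableTopology P :=
    NewtonianLattice.secondCountableTopology_of_measure_ball_pos μ fun x r hr => (hball x r hr).1
  have hlf : IsLocallyFiniteMeasure μ :=
    ⟨fun x => ⟨Metric.ball x 1, Metric.ball_mem_nhds x one_pos, (hball x 1 one_pos).2⟩⟩
  have hX : X.HasLscMajorants := hVC.elim (fun h => h.hasLscMajorants) fun h =>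
    h.hasLscMajorants fun x r hr => (hball x r hr).2
  have hq : ∀ w : P → EReal, X.MemNewton w → X.QuasiContinuous w := fun w hw =>
    hw.quasiContinuous hdense hX
  tfae_have 1 → 4 := hq u
  tfae_have 4 → 3 := fun h ε hε => by
    obtain ⟨E, -, hE, hcont⟩ := h ε hε
    exact ⟨E, hE, hcont⟩
  tfae_have 3 → 4 := fun h => h.quasiContinuous hq
  tfae_have 4 → 2 := fun h =>
    h.aeCurve_isAbsContAlong (hq v hv) huv hv.aeCurve_isAbsContAlong
  tfae_have 2 → 1 := fun h => h.memNewton hv huv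
  tfae_finish
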